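/- For $n\ge 1$ let $G_n=G(n,\tfrac18,3)$ be the random hypergraph on $[n]$ in which each set of $3$ vertices is an edge independently with probability $\tfrac18$, and let $T_n=T(n,\tfrac12)$ be the random $3$-uniform hypergraph on $[n]$ whose edges are the triangles of an Erdős–Rényi graph $G(n,\tfrac12)$. All $G_n$, $T_n$ are defined on one probability space, with arbitrary joint law. For a hypergraph $H$ on $[n]$ let $W_{ijk}=\tfrac1n$ if $\{i,j,k\}$ is an edge with three vertices, and $W_{ijk}=0$ otherwise (the normalized adjacency tensor of a $3$-uniform hypergraph), and let its $2$-action be the bilinear operator $$W[f,g]_{ik}=\tfrac12\Big(\sum_{j=1}^n W_{jik}f_{ji}g_{jk}+\sum_{j=1}^n W_{jki}f_{jk}g_{ji}\Big)$$ from pairs of symmetric $n\times n$ matrices to symmetric $n\times n$ matrices, regarded as an operator $L^\infty(\Omega_n)^2\to L^1(\Omega_n)$, where $\Omega_n$ is $[n]^2$ with the $\sigma$-algebra of the sets invariant under $(i,j)\mapsto(j,i)$ and the uniform probability measure. Write $\mathcal A_n$ and $\mathcal B_n$ for the operators obtained in this way from $G_n$ and $T_n$. For a bounded bilinear operator $A:L^\infty(\Omega)^2\to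 L^1(\Omega)$ over a probability space $\Omega$ (a multi-$P$-operator of order $3$), the $k$-profile $\mathcal S_k(A)$ is the set of the laws on $\mathbb R^{3k}$ of the random vectors $(f_1,g_1,A[f_1,g_1],\dots,f_k,g_k,A[f_k,g_k])$, where all $f_a,g_a\in L^\infty(\Omega)$ take values in $[-1,1]$ almost everywhere. Let $d_H$ be the Hausdorff distance with respect to the Lévy–Prokhorov metric and $d_M(A,B)=\sum_{k\ge1}2^{-k}d_H(\mathcal S_k(A),\mathcal S_k(B))$. A sequence $(A_n)$ of such operators, over possibly different probability spaces, is action convergent to $A$ if it is Cauchy in $d_M$ and $d_H(\mathcal S_k(A_n),\mathcal S_k(A))\to0$ for every $k$. Limits are identified when their $d_M$-distance is $0$. Then, almost surely, the following hold. 1. As $n\to\infty$, the law of $(\mathbb 1,\mathbb 1,\mathcal A_n[\mathbb 1,\mathbb 1])$ converges weakly to $\delta_{(1,1,1/8)}$, and the law of $(\mathbb 1,\mathbb 1,\mathcal B_n[\mathbb 1,\mathbb 1])$ converges weakly to $\tfrac12\delta_{(1,1,0)}+\tfrac12\delta_{(1,1,1/4)}$, where $\mathbb 1$ is the all-ones matrix.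 2. Every subsequence of $(\mathcal A_n)$ and every subsequence of $(\mathcal B_n)$ has a further subsequence that is action convergent to a multi-$P$-operator. 3. The limits are different: whenever a subsequence of $(\mathcal A_n)$ is action convergent to a multi-$P$-operator $A$ and a subsequence of $(\mathcal B_n)$ is action convergent to a multi-$P$-operator $B$, then $d_M(A,B)\neq0$. -/

import Mathlib

open MeasureTheory ProbabilityTheory Filter Topology
open scoped ENNReal

universe u v w

namespace ActionConv

noncomputable section

/-! ### Multi-`P`-operators -/

/-- A multi-`P`-operator taking `m` arguments (that is, of order `r = m + 1`): a probability space
`Ω` together with a bounded multilinear map `L^∞(Ω)^m → L¹(Ω)`. -/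
structure MultiPOperator (m : ℕ) : Type (u + 1) where
  /-- the probability space on which the operator acts -/
  Ω : Type u
  [mΩ : MeasurableSpace Ω]
  /-- its probability measure -/
  μ : Measure Ω
  [prob : IsProbabilityMeasure μ]
  /-- the operator; for multilinear maps of normed spaces, continuous is the same as bounded -/
  op : ContinuousMultilinearMap ℝ (fun _ : Fin m => Lp ℝ ∞ μ) (Lp ℝ 1 μ)

attribute [instance] MultiPOperator.mΩ MultiPOperator.prob

/-- The space `ℝ^{rk}`, `r = m + 1`, with its Euclidean distance; the coordinate `(a, b)` is the
`b`-th coordinate of the `a`-th block, a block having the length `r`. -/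
abbrev ProfileSpace (m k : ℕ) : Type := EuclideanSpace ℝ (Fin k × Fin (m + 1))

namespace MultiPOperator

variable {m : ℕ}

/-- The random vector `(f₁⁽¹⁾, …, f₁⁽ᵐ⁾, A[f₁⁽¹⁾, …, f₁⁽ᵐ⁾], …, f_k⁽¹⁾, …, f_k⁽ᵐ⁾, A[f_k⁽¹⁾, …, f_k⁽ᵐ⁾])`. -/
def randomVector (A : MultiPOperator.{u} m) {k : ℕ} (f : Fin k → Fin m → Lp ℝ ∞ A.μ) (ω : A.Ω) :
    ProfileSpace m k :=
  WithLp.toLp 2 fun q : Fin k × Fin (m + 1) =>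
    (Fin.snoc (fun j : Fin m => f q.1 j ω) (A.op (f q.1) ω) : Fin (m + 1) → ℝ) q.2

theorem measurable_randomVector (A : MultiPOperator.{u} m) {k : ℕ}
    (f : Fin k → Fin m → Lp ℝ ∞ A.μ) : Measurable (A.randomVector f) := by
  refine (WithLp.measurable_toLp 2 _).comp (measurable_pi_lambda _ ?_)
  rintro ⟨a, b⟩
  refine Fin.lastCases ?_ (fun j => ?_) b
  · simpa using (Lp.stronglyMeasurable (A.op (f a))).measurable
  · simpa using (Lp.stronglyMeasurable (f a j)).measurable

/-- The measure generated by `A` through the functions `f`: the law of the random vector above. -/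
def law (A : MultiPOperator.{u} m) {k : ℕ} (f : Fin k → Fin m → Lp ℝ ∞ A.μ) :
    ProbabilityMeasure (ProfileSpace m k) :=
  ⟨A.μ.map (A.randomVector f),
    Measure.isProbabilityMeasure_map (A.measurable_randomVector f).aemeasurable⟩

/-- The `k`-profile `S_k(A)`: all measures generated by `A` through functions with values in
`[-1, 1]` almost everywhere, as a set in the Lévy–Prokhorov metric space of probability measures. -/
def profile (A : MultiPOperator.{u} m) (k : ℕ) :
    Set (LevyProkhorov (ProbabilityMeasure (ProfileSpace m k))) :=
  {ν | ∃ f : Fin k → Fin m → Lp ℝ ∞ A.μ,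
    (∀ a j, ∀ᵐ ω ∂A.μ, f a j ω ∈ Set.Icc (-1 : ℝ) 1) ∧ ν = LevyProkhorov.ofMeasure (A.law f)}

/-- `d_M(A, B) = ∑_{k ≥ 1} 2^{-k} d_H(S_k(A), S_k(B))`. All terms are nonnegative, and
the value is finite because Lévy–Prokhorov distances of probability measures are at most `1`. -/
def actionDist (A : MultiPOperator.{u} m) (B : MultiPOperator.{v} m) : ℝ≥0∞ :=
  ∑' k : ℕ, (2 : ℝ≥0∞)⁻¹ ^ (k + 1) *
    Metric.hausdorffEDist (A.profile (k + 1)) (B.profile (k + 1))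

/-- The sequence is Cauchy in `d_M`. -/
def IsActionCauchy (A : ℕ → MultiPOperator.{u} m) : Prop :=
  ∀ ε : ℝ≥0∞, 0 < ε → ∃ N, ∀ i ≥ N, ∀ j ≥ N, actionDist (A i) (A j) < ε

/-- The sequence is action convergent to `L`: it is Cauchy in `d_M`, and for every `k` its
`k`-profiles converge to the `k`-profile of `L` in the Hausdorff metric. -/
structure ActionConvergesTo (A : ℕ → MultiPOperator.{u} m) (L : MultiPOperator.{v} m) : Prop where
  cauchy : IsActionCauchy A
  tendsto_profile : ∀ k : ℕ, Tendsto (fun i => Metric.hausdorffEDist ((A i).profile k) (L.profile k))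
    atTop (𝓝 0)

/-- The constant function `1` on the probability space of `A`. -/
def one (A : MultiPOperator.{u} m) : Lp ℝ ∞ A.μ := Lp.const ∞ A.μ (1 : ℝ)

/-- The law of `(1, …, 1, A[1, …, 1])`, an element of the `1`-profile of `A`. -/
def lawOne (A : MultiPOperator.{u} m) : ProbabilityMeasure (ProfileSpace m 1) :=
  A.law fun _ _ => A.one

end MultiPOperator

/-! ### The probability space `([n]², Sym)` -/

/-- The set `V × V` of ordered pairs, to be equipped with the symmetric `σ`-algebra. -/
structure SymSquare (V : Type u) : Type u where
  fst : V
  snd : V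

instance SymSquare.instFinite (V : Type u) [Finite V] : Finite (SymSquare V) :=
  Finite.of_injective (fun p : SymSquare V => (p.fst, p.snd)) fun p q h => by
    cases p; cases q; simpa using h

/-- The symmetric `σ`-algebra: its measurable sets are those that are invariant under
`(i, j) ↦ (j, i)`. -/
instance SymSquare.instMeasurableSpace (V : Type u) : MeasurableSpace (SymSquare V) where
  MeasurableSet' s := ∀ i j : V, SymSquare.mk i j ∈ s → SymSquare.mk j i ∈ s
  measurableSet_empty := fun _ _ h => h
  measurableSet_compl := fun _ hs i j h h' => h (hs j i h')
  measurableSet_iUnion := fun s hs i j h => by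
    obtain ⟨t, ht⟩ := Set.mem_iUnion.1 h
    exact Set.mem_iUnion.2 ⟨t, hs t i j ht⟩

/-- The uniform probability measure `|V|⁻² ∑_{i, j} δ_{(i, j)}`. -/
def uniform (V : Type u) [Fintype V] : Measure (SymSquare V) :=
  ((Fintype.card V : ℝ≥0∞) ^ 2)⁻¹ • ∑ i : V, ∑ j : V, Measure.dirac (SymSquare.mk i j)

variable {V : Type u} [Fintype V]

instance uniform.instIsProbabilityMeasure [Nonempty V] : IsProbabilityMeasure (uniform V) := by
  constructor
  have h0 : (Fintype.card V : ℝ≥0∞) ≠ 0 := by simp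
  have h1 : (Fintype.card V : ℝ≥0∞) ≠ ∞ := ENNReal.natCast_ne_top _
  simp only [uniform, Measure.smul_apply, Measure.coe_finsetSum, Finset.sum_apply, measure_univ,
    Finset.sum_const, Finset.card_univ, smul_eq_mul, nsmul_eq_mul, mul_one]
  rw [← pow_two]
  exact ENNReal.inv_mul_cancel (pow_ne_zero 2 h0) (ENNReal.pow_ne_top h1)

/-- Real functions on `V × V` are measurable for the symmetric `σ`-algebra iff they are
symmetric matrices. -/
theorem SymSquare.measurable_iff {V : Type u} (f : SymSquare V → ℝ) :
    Measurable f ↔ ∀ i j : V, f ⟨i, j⟩ = f ⟨j, i⟩ := by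
  constructor
  · intro h i j
    exact (h (measurableSet_singleton (f ⟨i, j⟩)) i j rfl).symm
  · intro h s _ i j hij
    change f ⟨j, i⟩ ∈ s
    rw [← h i j]
    exact hij

theorem ae_uniform_iff (q : SymSquare V → Prop) : (∀ᵐ p ∂uniform V, q p) ↔ ∀ p, q p := by
  refine ⟨fun h p => ?_, fun h => Eventually.of_forall h⟩
  have hc : ((Fintype.card V : ℝ≥0∞) ^ 2)⁻¹ ≠ 0 :=
    ENNReal.inv_ne_zero.2 (ENNReal.pow_ne_top (ENNReal.natCast_ne_top _))
  rw [uniform, ae_iff, Measure.smul_apply, smul_eq_mul, mul_eq_zero] at h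
  have h := h.resolve_left hc
  simp only [Measure.coe_finsetSum, Finset.sum_apply, Finset.sum_eq_zero_iff, Finset.mem_univ,
    true_imp_iff] at h
  by_contra hp
  have h1 := h p.fst p.snd
  have h2 := Measure.le_dirac_apply (a := SymSquare.mk p.fst p.snd) (s := {a : SymSquare V | ¬ q a})
  rw [h1] at h2
  simp [Set.indicator_of_mem (show SymSquare.mk p.fst p.snd ∈ {a : SymSquare V | ¬ q a} from hp)]
    at h2

theorem memLp_uniform [Nonempty V] {f : SymSquare V → ℝ} (hf : Measurable f) (p : ℝ≥0∞) :
    MemLp f p (uniform V) := by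
  obtain ⟨C, hC⟩ := (Set.finite_range (fun q : SymSquare V => ‖f q‖)).bddAbove
  exact MemLp.of_bound hf.aestronglyMeasurable C
    (Eventually.of_forall fun q => hC (Set.mem_range_self q))

/-! ### Tensors and their `2`-action -/

/-- Tensors of order `r` with index set `V`. -/
abbrev Tensor (r : ℕ) (V : Type u) : Type u := (Fin r → V) → ℝ

/-- The `2`-action of a third-order tensor on a pair of matrices:
`T[f, g]_{ik} = ½ (∑_j T_{jik} f_{ji} g_{jk} + ∑_j T_{jki} f_{jk} g_{ji})`. -/
def twoActionFun (T : Tensor 3 V) (f g : SymSquare V → ℝ) (p : SymSquare V) : ℝ :=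
  1 / 2 * (∑ j : V, T ![j, p.fst, p.snd] * f ⟨j, p.fst⟩ * g ⟨j, p.snd⟩ +
    ∑ j : V, T ![j, p.snd, p.fst] * f ⟨j, p.snd⟩ * g ⟨j, p.fst⟩)

theorem measurable_twoActionFun (T : Tensor 3 V) (f g : SymSquare V → ℝ) :
    Measurable (twoActionFun T f g) := by
  rw [SymSquare.measurable_iff]
  intro i j
  simp only [twoActionFun]
  rw [add_comm]

theorem abs_twoActionFun_le (T : Tensor 3 V) (f g : SymSquare V → ℝ) {a b : ℝ}
    (hf : ∀ p, |f p| ≤ a) (hg : ∀ p, |g p| ≤ b) (p : SymSquare V) :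
    |twoActionFun T f g p| ≤ (∑ t : V, ∑ i : V, ∑ k : V, |T ![t, i, k]|) * (a * b) := by
  have ha : 0 ≤ a := (abs_nonneg _).trans (hf p)
  have key : ∀ i k : V, |∑ j : V, T ![j, i, k] * f ⟨j, i⟩ * g ⟨j, k⟩| ≤
      (∑ t : V, ∑ i : V, ∑ k : V, |T ![t, i, k]|) * (a * b) := by
    intro i k
    refine (Finset.abs_sum_le_sum_abs _ _).trans ?_
    rw [Finset.sum_mul]
    refine Finset.sum_le_sum fun j _ => ?_
    rw [mul_assoc, abs_mul, abs_mul]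
    refine mul_le_mul ?_ (mul_le_mul (hf _) (hg _) (abs_nonneg _) ha) (by positivity)
      (Finset.sum_nonneg fun _ _ => Finset.sum_nonneg fun _ _ => abs_nonneg _)
    exact (Finset.single_le_sum (f := fun k' => |T ![j, i, k']|) (fun _ _ => abs_nonneg _)
      (Finset.mem_univ k)).trans
      (Finset.single_le_sum (f := fun i' => ∑ k' : V, |T ![j, i', k']|)
        (fun _ _ => Finset.sum_nonneg fun _ _ => abs_nonneg _) (Finset.mem_univ i))
  have h1 := key p.fst p.snd
  have h2 := key p.snd p.fst
  have h3 := abs_add_le (∑ j : V, T ![j, p.fst, p.snd] * f ⟨j, p.fst⟩ * g ⟨j, p.snd⟩)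
    (∑ j : V, T ![j, p.snd, p.fst] * f ⟨j, p.snd⟩ * g ⟨j, p.fst⟩)
  rw [twoActionFun, abs_mul, abs_of_pos (by norm_num : (0 : ℝ) < 1 / 2)]
  linarith

/-- The `2`-action of a third-order tensor as a multilinear map
`L^∞([n]², Sym)² → L¹([n]², Sym)`. -/
def twoActionMultilinear [Nonempty V] (T : Tensor 3 V) :
    MultilinearMap ℝ (fun _ : Fin 2 => Lp ℝ ∞ (uniform V)) (Lp ℝ 1 (uniform V)) where
  toFun f := (memLp_uniform (measurable_twoActionFun T (f 0) (f 1)) 1).toLp _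
  map_update_add' := by
    intro _ f a x y
    have hxy := (ae_uniform_iff _).1 (Lp.coeFn_add x y)
    rw [← MemLp.toLp_add, MemLp.toLp_eq_toLp_iff]
    refine Eventually.of_forall fun p => ?_
    fin_cases a <;>
    · simp only [twoActionFun, Fin.zero_eta, Fin.mk_one, Fin.isValue, Function.update_self, ne_eq,
        zero_ne_one, one_ne_zero, not_false_eq_true, Function.update_of_ne, hxy, Pi.add_apply,
        mul_add, add_mul, Finset.sum_add_distrib]
      ring
  map_update_smul' := by
    intro _ f a c x
    have hx := (ae_uniform_iff _).1 (Lp.coeFn_smul c x)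
    rw [← MemLp.toLp_const_smul, MemLp.toLp_eq_toLp_iff]
    refine Eventually.of_forall fun p => ?_
    fin_cases a <;>
    · simp only [twoActionFun, Fin.zero_eta, Fin.mk_one, Fin.isValue, Function.update_self, ne_eq,
        zero_ne_one, one_ne_zero, not_false_eq_true, Function.update_of_ne, hx, Pi.smul_apply,
        smul_eq_mul, Finset.mul_sum, mul_add]
      congr 1 <;> refine Finset.sum_congr rfl fun _ _ => by ring

theorem norm_twoActionMultilinear_le [Nonempty V] (T : Tensor 3 V)
    (f : Fin 2 → Lp ℝ ∞ (uniform V)) :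
    ‖twoActionMultilinear T f‖ ≤ (∑ t : V, ∑ i : V, ∑ k : V, |T ![t, i, k]|) * ∏ a, ‖f a‖ := by
  have hb : ∀ h : Lp ℝ ∞ (uniform V), ∀ p, |h p| ≤ ‖h‖ := fun h => by
    refine (ae_uniform_iff _).1 ?_
    have hfin : eLpNormEssSup h (uniform V) ≠ ∞ := by
      rw [← eLpNorm_exponent_top]
      exact (Lp.memLp h).2.ne
    filter_upwards [enorm_ae_le_eLpNormEssSup h (uniform V)] with p hp
    rw [Lp.norm_def, eLpNorm_exponent_top, ← Real.norm_eq_abs, ← toReal_enorm]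
    exact ENNReal.toReal_mono hfin hp
  have hC : 0 ≤ (∑ t : V, ∑ i : V, ∑ k : V, |T ![t, i, k]|) * (‖f 0‖ * ‖f 1‖) :=
    mul_nonneg (Finset.sum_nonneg fun _ _ => Finset.sum_nonneg fun _ _ =>
      Finset.sum_nonneg fun _ _ => abs_nonneg _) (by positivity)
  have h := Lp.norm_le_of_ae_bound (f := twoActionMultilinear T f) hC (by
    filter_upwards [MemLp.coeFn_toLp (memLp_uniform (measurable_twoActionFun T (f 0) (f 1)) 1)]
      with p hp
    change ‖(MemLp.toLp _ (memLp_uniform (measurable_twoActionFun T (f 0) (f 1)) 1)) p‖ ≤ _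
    rw [hp]
    exact abs_twoActionFun_le T _ _ (hb _) (hb _) p)
  have hu : measureUnivNNReal (uniform V) = 1 := by simp [measureUnivNNReal]
  simpa [Fin.prod_univ_two, hu] using h

/-- The `2`-action of a third-order tensor as a multi-`P`-operator on `([n]², Sym)` with the
uniform probability measure. -/
def twoAction [Nonempty V] (T : Tensor 3 V) : MultiPOperator.{u} 2 where
  Ω := SymSquare V
  μ := uniform V
  op := (twoActionMultilinear T).mkContinuous _ (norm_twoActionMultilinear_le T)

/-! ### Hypergraphs -/

open Classical in
/-- The adjacency tensor of order `r` of a hypergraph whose largest edges have `r` vertices: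
the entry at `(i₁, …, i_r)` is `1` if `{i₁, …, i_r}` is an edge, and `0` otherwise. -/
def adjacencyTensor {V : Type u} (r : ℕ) (H : Hypergraph V) : Tensor r V :=
  fun i => if Set.range i ∈ H.edgeSet then 1 else 0

/-- The normalized `2`-action of a `3`-uniform hypergraph: the `2`-action of `A(H) / n`, where `n`
is the number of vertices. -/
def normalizedTwoAction [Nonempty V] (H : Hypergraph V) : MultiPOperator.{u} 2 :=
  twoAction fun i => adjacencyTensor 3 H i / Fintype.card V

/-- The `3`-uniform hypergraph with edges the triangles of a graph on the same vertex set. -/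
def triangleHypergraph {V : Type u} (G : SimpleGraph V) : Hypergraph V where
  vertexSet := Set.univ
  edgeSet := {e | ∃ s : Finset V, G.IsNClique 3 s ∧ e = (s : Set V)}
  subset_vertexSet_of_mem_edgeSet' := fun _ _ => Set.subset_univ _

/-- `H` is a random hypergraph `G(n, p, r)` with vertex set `V`, `n = |V|`: every set of `r`
vertices is an edge with probability `p`, independently, and there are no other edges. -/
structure IsErdosRenyiHypergraph {V : Type u} {Ξ : Type v} [MeasurableSpace Ξ]
    (H : Ξ → Hypergraph V) (p : unitInterval) (r : ℕ) (P : Measure Ξ) : Prop where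
  vertexSet_eq : ∀ ξ, (H ξ).vertexSet = Set.univ
  hasLaw : HasLaw (fun ξ => (H ξ).edgeSet) (setBernoulli {e : Set V | e.ncard = r} p) P

/-- `H` is a random hypergraph `T(n, p)` with vertex set `V`, `n = |V|`: its edges are the
triangles of an Erdős–Rényi random graph `G(n, p)`. -/
def IsTriangleHypergraph {V : Type u} {Ξ : Type v} [MeasurableSpace Ξ]
    (H : Ξ → Hypergraph V) (p : unitInterval) (P : Measure Ξ) : Prop :=
  ∃ G : Ξ → SimpleGraph V, HasLaw G (SimpleGraph.binomialRandom V p) P ∧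
    ∀ ξ, H ξ = triangleHypergraph (G ξ)

/-- The number `1/8` as a probability. -/
def oneEighth : unitInterval := ⟨1 / 8, by norm_num, by norm_num⟩

/-- The number `1/2` as a probability. -/
def oneHalf : unitInterval := ⟨1 / 2, by norm_num, by norm_num⟩

/-! ### Measures on `ℝ³` -/

/-- The point `(x, y, z)` of `ℝ³`. -/
def point (x y z : ℝ) : ProfileSpace 2 1 :=
  WithLp.toLp 2 fun q : Fin 1 × Fin 3 => (![x, y, z] : Fin 3 → ℝ) q.2

/-- The Dirac measure `δ_a`. -/
def diracProb (a : ProfileSpace 2 1) : ProbabilityMeasure (ProfileSpace 2 1) :=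
  ⟨Measure.dirac a, inferInstance⟩

/-- The measure `½ δ_a + ½ δ_b`. -/
def diracMix (a b : ProfileSpace 2 1) : ProbabilityMeasure (ProfileSpace 2 1) :=
  ⟨(2 : ℝ≥0∞)⁻¹ • Measure.dirac a + (2 : ℝ≥0∞)⁻¹ • Measure.dirac b, by
    constructor
    simp [ENNReal.inv_two_add_inv_two]⟩

end

end ActionConv

open ActionConv

set_option linter.unusedSectionVars false

namespace ActionConv

noncomputable section

/-! ### Integration over the symmetric square -/

section Uniform

variable {V : Type u} [Fintype V]

/-! Constant inputs. Applied to the all-ones matrices, the operator of a hypergraph has the entries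
codegree$/n$. For $i\ne k$ the codegree in $G_n$ is a sum of $n-2$ independent indicators of mean
$\frac18$. In $T_n$ it is the adjacency indicator of $ik$ times the number of common neighbours of
$i$ and $k$, a sum of $n-2$ independent indicators of mean $\frac14$. Hoeffding's inequality, a
union bound over at most $n^2$ pairs and Borel–Cantelli make both estimates almost surely uniform in
$i\ne k$ (`ae_eventually_abs_sum_lt`). The edge density of the graph tends to $\frac12$ in the same
way, and the diagonal has mass $1/n$. Only the law of each single hypergraph enters, so the joint
law is irrelevant.

Compactness is deterministic: any sequence of tensors with entries at most $1/n$ in absolute value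
has an action convergent subsequence. Let $X$ be the Stone–Čech compactification of the disjoint
union of the sets of unordered pairs. A continuous function on $X$ is the same as a uniformly
bounded sequence of symmetric matrices, so the operators, applied level by level, act on $C(X)$. The
uniform measures converge along an ultrafilter to a measure $\mu$ on $X$. The $L^1\times L^\infty$
and $L^\infty\times L^1$ bounds, uniform in $n$, survive in the limit, so the action respects
$\mu$-almost everywhere equality (`limitAction_congr`). A diagonal argument gives every bounded
measurable function a continuous representative (`IsLimitMeasure.exists_continuousMap_ae_eq`), so
the action descends to $L^\infty(\mu)$. A sequence of inputs on the finite levels is a tuple of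
continuous functions on $X$ and conversely, so laws converge along the ultrafilter, and compactness
of the measures on a cube upgrades this to Hausdorff convergence of profiles.

Separation. If two limits had distance $0$, the $1$-profiles along the two subsequences would
approach each other, and the law of $(\mathbb 1,\mathbb 1,\mathcal B_n[\mathbb 1,\mathbb 1])$ would
be close to the law of some $(f,g,\mathcal A_n[f,g])$. Then $f$ and $g$ are close to $\mathbb 1$ in
$L^1$, and the same bounds force $\mathcal A_n[f,g]$ to be close in $L^1$ to $\mathcal A_n[\mathbb
1,\mathbb 1]\approx\frac18$. But its law is close to $\frac12\delta_0+\frac12\delta_{1/4}$, a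
contradiction (`not_tendsto_hausdorffEDist_profile_one`). -/

theorem integral_uniform {f : SymSquare V → ℝ} (hf : Measurable f) :
    ∫ p, f p ∂uniform V = ((Fintype.card V : ℝ) ^ 2)⁻¹ * ∑ i : V, ∑ j : V, f ⟨i, j⟩ := by
  have hi : ∀ i j : V, Integrable f (Measure.dirac (SymSquare.mk i j)) := fun i j =>
    integrable_dirac' hf.stronglyMeasurable (by simp)
  rw [uniform, integral_smul_measure, integral_finsetSum_measure]
  · simp only [smul_eq_mul, ENNReal.toReal_inv, ENNReal.toReal_pow, ENNReal.toReal_natCast]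
    congr 1
    refine Finset.sum_congr rfl fun i _ => ?_
    rw [integral_finsetSum_measure fun j _ => hi i j]
    exact Finset.sum_congr rfl fun j _ => integral_dirac' _ _ hf.stronglyMeasurable
  · intro i _
    exact integrable_finsetSum_measure.2 fun j _ => hi i j

theorem measurable_coe_lp {p : ℝ≥0∞} (h : Lp ℝ p (uniform V)) : Measurable h :=
  (Lp.stronglyMeasurable h).measurable

/-- Almost everywhere for `uniform V` means everywhere, so on the finite levels `Lp` classes may be
treated as functions. -/
theorem coe_toLp_uniform {f : SymSquare V → ℝ} {p : ℝ≥0∞} (hf : MemLp f p (uniform V)) :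
    ⇑(hf.toLp f) = f :=
  funext ((ae_uniform_iff _).1 hf.coeFn_toLp)

/-! ### Bounds for the `2`-action -/

theorem twoActionFun_add_left (T : Tensor 3 V) (f f' g : SymSquare V → ℝ) (p : SymSquare V) :
    twoActionFun T (fun q => f q + f' q) g p = twoActionFun T f g p + twoActionFun T f' g p := by
  simp only [twoActionFun, mul_add, add_mul, Finset.sum_add_distrib]
  ring

theorem twoActionFun_add_right (T : Tensor 3 V) (f g g' : SymSquare V → ℝ) (p : SymSquare V) :
    twoActionFun T f (fun q => g q + g' q) p = twoActionFun T f g p + twoActionFun T f g' p := by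
  simp only [twoActionFun, mul_add, Finset.sum_add_distrib]
  ring

theorem twoActionFun_smul_left (T : Tensor 3 V) (c : ℝ) (f g : SymSquare V → ℝ)
    (p : SymSquare V) :
    twoActionFun T (fun q => c * f q) g p = c * twoActionFun T f g p := by
  simp only [twoActionFun, Finset.mul_sum, mul_add]
  congr 1 <;> exact Finset.sum_congr rfl fun _ _ => by ring

theorem twoActionFun_smul_right (T : Tensor 3 V) (c : ℝ) (f g : SymSquare V → ℝ)
    (p : SymSquare V) :
    twoActionFun T f (fun q => c * g q) p = c * twoActionFun T f g p := by
  simp only [twoActionFun, Finset.mul_sum, mul_add]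
  congr 1 <;> exact Finset.sum_congr rfl fun _ _ => by ring

/-- The tensor `T` has entries of absolute value at most `1 / |V|`. -/
def NormalizedTensor (T : Tensor 3 V) : Prop := ∀ x, |T x| ≤ (Fintype.card V : ℝ)⁻¹

theorem NormalizedTensor.abs_twoActionFun_le {T : Tensor 3 V} (hT : NormalizedTensor T)
    (f g : SymSquare V → ℝ) (p : SymSquare V) :
    |twoActionFun T f g p| ≤ 1 / 2 * (∑ j : V, (Fintype.card V : ℝ)⁻¹ *
      (|f ⟨j, p.fst⟩| * |g ⟨j, p.snd⟩|) + ∑ j : V, (Fintype.card V : ℝ)⁻¹ *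
      (|f ⟨j, p.snd⟩| * |g ⟨j, p.fst⟩|)) := by
  have key : ∀ i k : V, |∑ j : V, T ![j, i, k] * f ⟨j, i⟩ * g ⟨j, k⟩| ≤
      ∑ j : V, (Fintype.card V : ℝ)⁻¹ * (|f ⟨j, i⟩| * |g ⟨j, k⟩|) := by
    intro i k
    refine (Finset.abs_sum_le_sum_abs _ _).trans (Finset.sum_le_sum fun j _ => ?_)
    rw [mul_assoc, abs_mul, abs_mul]
    exact mul_le_mul_of_nonneg_right (hT _) (by positivity)
  rw [twoActionFun, abs_mul, abs_of_pos (by norm_num : (0 : ℝ) < 1 / 2)]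
  refine mul_le_mul_of_nonneg_left ((abs_add_le _ _).trans (add_le_add (key _ _) (key _ _)))
    (by norm_num)

variable [Nonempty V]

theorem integrable_uniform {f : SymSquare V → ℝ} (hf : Measurable f) :
    Integrable f (uniform V) :=
  memLp_one_iff_integrable.1 (memLp_uniform hf 1)

theorem coe_op_twoAction (T : Tensor 3 V) (f : Fin 2 → Lp ℝ ∞ (uniform V)) :
    ⇑((twoAction T).op f) = twoActionFun T (f 0) (f 1) :=
  coe_toLp_uniform (memLp_uniform (measurable_twoActionFun T (f 0) (f 1)) 1)

theorem NormalizedTensor.abs_twoActionFun_le_mul {T : Tensor 3 V} (hT : NormalizedTensor T)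
    {f g : SymSquare V → ℝ} {a b : ℝ} (hf : ∀ p, |f p| ≤ a) (hg : ∀ p, |g p| ≤ b)
    (p : SymSquare V) : |twoActionFun T f g p| ≤ a * b := by
  have ha : 0 ≤ a := (abs_nonneg _).trans (hf p)
  have hc : (Fintype.card V : ℝ) ≠ 0 := by simp
  have key : ∀ i k : V, ∑ j : V, (Fintype.card V : ℝ)⁻¹ * (|f ⟨j, i⟩| * |g ⟨j, k⟩|) ≤ a * b := by
    intro i k
    calc _ ≤ ∑ _j : V, (Fintype.card V : ℝ)⁻¹ * (a * b) :=
          Finset.sum_le_sum fun j _ => mul_le_mul_of_nonneg_left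
            (mul_le_mul (hf _) (hg _) (abs_nonneg _) ha) (by positivity)
      _ = a * b := by
          rw [Finset.sum_const, Finset.card_univ, nsmul_eq_mul, ← mul_assoc, mul_inv_cancel₀ hc,
            one_mul]
  have h1 := key p.fst p.snd
  have h2 := key p.snd p.fst
  have h3 := hT.abs_twoActionFun_le f g p
  linarith

/-- Each of the two sums depends on one endpoint only; averaged over all pairs, each becomes `b`
times the mean of `|h|`, and the factor `1 / 2` turns their sum into a mean. -/
theorem integral_abs_le_of_sum_bound {F h : SymSquare V → ℝ} (hF : Measurable F)
    (hh : Measurable h) (b : ℝ)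
    (hb : ∀ p : SymSquare V, |F p| ≤ 1 / 2 * (∑ j : V, (Fintype.card V : ℝ)⁻¹ *
      (b * |h ⟨j, p.fst⟩|) + ∑ j : V, (Fintype.card V : ℝ)⁻¹ * (b * |h ⟨j, p.snd⟩|))) :
    ∫ p, |F p| ∂uniform V ≤ b * ∫ p, |h p| ∂uniform V := by
  have hc : (Fintype.card V : ℝ) ≠ 0 := by simp
  rw [integral_uniform (by fun_prop), integral_uniform (by fun_prop)]
  have e1 : ∑ i : V, ∑ k : V, 1 / 2 * (∑ j : V, (Fintype.card V : ℝ)⁻¹ *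
      (b * |h ⟨j, i⟩|) + ∑ j : V, (Fintype.card V : ℝ)⁻¹ * (b * |h ⟨j, k⟩|)) =
      b * ∑ i : V, ∑ j : V, |h ⟨i, j⟩| := by
    have hs : ∑ i : V, ∑ j : V, |h ⟨j, i⟩| = ∑ i : V, ∑ j : V, |h ⟨i, j⟩| := Finset.sum_comm
    simp only [mul_add, Finset.sum_add_distrib, Finset.sum_const, Finset.card_univ, nsmul_eq_mul,
      ← Finset.mul_sum, hs]
    field_simp
    ring
  calc _ ≤ ((Fintype.card V : ℝ) ^ 2)⁻¹ * (b * ∑ i : V, ∑ j : V, |h ⟨i, j⟩|) := by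
        rw [← e1]
        exact mul_le_mul_of_nonneg_left
          (Finset.sum_le_sum fun i _ => Finset.sum_le_sum fun k _ => hb ⟨i, k⟩) (by positivity)
    _ = _ := by ring

/-- The $L^1\times L^\infty\to L^1$ bound, with a constant independent of `V`. Together with its
mirror image it makes the limit action well defined on almost everywhere classes, and it is the
continuity that separates the limits. -/
theorem NormalizedTensor.integral_abs_twoActionFun_le_left {T : Tensor 3 V}
    (hT : NormalizedTensor T) {f g : SymSquare V → ℝ} (hf : Measurable f) {b : ℝ}
    (hg : ∀ p, |g p| ≤ b) :
    ∫ p, |twoActionFun T f g p| ∂uniform V ≤ b * ∫ p, |f p| ∂uniform V := by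
  refine integral_abs_le_of_sum_bound (measurable_twoActionFun T f g) hf b fun p =>
    (hT.abs_twoActionFun_le f g p).trans ?_
  gcongr 1 / 2 * (?_ + ?_) <;>
  · refine Finset.sum_le_sum fun j _ => mul_le_mul_of_nonneg_left ?_ (by positivity)
    rw [mul_comm]
    exact mul_le_mul_of_nonneg_right (hg _) (abs_nonneg _)

theorem NormalizedTensor.integral_abs_twoActionFun_le_right {T : Tensor 3 V}
    (hT : NormalizedTensor T) {f g : SymSquare V → ℝ} (hg : Measurable g) {a : ℝ}
    (hf : ∀ p, |f p| ≤ a) :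
    ∫ p, |twoActionFun T f g p| ∂uniform V ≤ a * ∫ p, |g p| ∂uniform V := by
  refine integral_abs_le_of_sum_bound (measurable_twoActionFun T f g) hg a fun p =>
    (hT.abs_twoActionFun_le f g p).trans ?_
  rw [add_comm]
  gcongr 1 / 2 * (?_ + ?_) <;>
  · refine Finset.sum_le_sum fun j _ => mul_le_mul_of_nonneg_left ?_ (by positivity)
    exact mul_le_mul_of_nonneg_right (hf _) (abs_nonneg _)

theorem normalizedTensor_adjacencyTensor (H : Hypergraph V) :
    NormalizedTensor fun i => adjacencyTensor 3 H i / Fintype.card V := by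
  intro x
  have h : |adjacencyTensor 3 H x| ≤ 1 := by
    unfold adjacencyTensor
    split_ifs <;> simp
  rw [abs_div, Nat.abs_cast, div_eq_mul_inv]
  exact mul_le_of_le_one_left (by positivity) h

end Uniform

/-! ### A compact space carrying all symmetric squares -/

instance instMeasurableSpaceUltrafilter (α : Type u) : MeasurableSpace (Ultrafilter α) := borel _

instance instBorelSpaceUltrafilter (α : Type u) : BorelSpace (Ultrafilter α) := ⟨rfl⟩

/-- The Stone–Čech compactification of the disjoint union of the sets of unordered pairs. -/
abbrev PairSpace (V : ℕ → Type) : Type := Ultrafilter (Σ n, Sym2 (V n))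

section Compactification

variable {V : ℕ → Type}

/-- The canonical map from the `n`-th symmetric square to the compactification. -/
def embed (n : ℕ) (p : SymSquare (V n)) : PairSpace V := pure ⟨n, s(p.fst, p.snd)⟩

theorem measurable_embed (n : ℕ) : Measurable (embed (V := V) n) := by
  intro s _ i j h
  have h' : (pure ⟨n, s(i, j)⟩ : PairSpace V) ∈ s := h
  rw [Sym2.eq_swap] at h'
  exact h'

theorem measurable_comp_embed (F : C(PairSpace V, ℝ)) (n : ℕ) :
    Measurable fun p => F (embed n p) :=
  F.continuous.measurable.comp (measurable_embed n)

/-- A bounded family of symmetric matrices extends to a continuous function. -/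
theorem exists_continuousMap_embed {f : ∀ n, SymSquare (V n) → ℝ} (hf : ∀ n, Measurable (f n))
    {M : ℝ} (hM : ∀ n p, |f n p| ≤ M) : ∃ F : C(PairSpace V, ℝ), ∀ n p, F (embed n p) = f n p := by
  have hs : ∀ n, ∀ i j : V n, f n ⟨i, j⟩ = f n ⟨j, i⟩ := fun n =>
    (SymSquare.measurable_iff _).1 (hf n)
  -- The universal property of the Stone–Čech compactification needs a compact target, hence the
  -- interval in place of `ℝ`.
  let s : (Σ n, Sym2 (V n)) → Set.Icc (-M) M := fun y =>
    ⟨Sym2.lift ⟨fun i j => f y.1 ⟨i, j⟩, hs y.1⟩ y.2, by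
      obtain ⟨n, e⟩ := y
      induction e with
      | _ i j => exact abs_le.1 (hM n ⟨i, j⟩)⟩
  refine ⟨⟨fun x => ((Ultrafilter.extend s x : Set.Icc (-M) M) : ℝ),
    continuous_subtype_val.comp (continuous_ultrafilter_extend s)⟩, fun n p => ?_⟩
  simp [embed, s]

/-- Principal ultrafilters are dense, and the inequality is a closed condition. -/
theorem abs_le_of_forall_embed {F : C(PairSpace V, ℝ)} {M : ℝ}
    (h : ∀ n p, |F (embed n p)| ≤ M) (x : PairSpace V) : |F x| ≤ M := by
  refine denseRange_pure.induction_on (p := fun x => |F x| ≤ M) x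
    (isClosed_le (by fun_prop) continuous_const) ?_
  rintro ⟨n, e⟩
  induction e with
  | _ i j => exact h n ⟨i, j⟩

theorem continuousMap_ext_embed {F G : C(PairSpace V, ℝ)}
    (h : ∀ n p, F (embed n p) = G (embed n p)) : F = G := by
  ext x
  have := abs_le_of_forall_embed (F := F - G) (M := 0) (fun n p => by simp [h]) x
  simpa [sub_eq_zero] using this

theorem integrable_continuousMap {μ : Measure (PairSpace V)} [IsProbabilityMeasure μ]
    (F : C(PairSpace V, ℝ)) :
    Integrable F μ :=
  Integrable.of_bound F.continuous.aestronglyMeasurable ‖F‖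
    (Eventually.of_forall F.norm_coe_le_norm)

theorem abs_sub_clip_le {M h g : ℝ} (hh : |h| ≤ M) :
    |h - max (-M) (min M g)| ≤ |h - g| := by
  rw [abs_le] at hh
  rcases le_total M g with h1 | h1
  · rw [min_eq_left h1, max_eq_right (by linarith), abs_of_nonpos (by linarith),
      abs_of_nonpos (by linarith)]
    linarith
  · rw [min_eq_right h1]
    rcases le_total (-M) g with h2 | h2
    · rw [max_eq_right h2]
    · rw [max_eq_left h2, abs_of_nonneg (by linarith), abs_of_nonneg (by linarith)]
      linarith

theorem abs_clip_le {M : ℝ} (hM : 0 ≤ M) (g : ℝ) : |max (-M) (min M g)| ≤ M :=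
  abs_le.2 ⟨le_max_left _ _, max_le (by linarith) (min_le_left _ _)⟩

/-- Bounded measurable functions are approximated in `L¹` by continuous functions with the same
bound. -/
theorem exists_continuousMap_integral_abs_sub_le {μ : Measure (PairSpace V)} [IsProbabilityMeasure μ]
    [μ.Regular] {h : PairSpace V → ℝ}
    (hm : AEStronglyMeasurable h μ) {M : ℝ} (hb : ∀ᵐ x ∂μ, |h x| ≤ M) {ε : ℝ} (hε : 0 < ε) :
    ∃ F : C(PairSpace V, ℝ), (∀ x, |F x| ≤ M) ∧ ∫ x, |h x - F x| ∂μ ≤ ε := by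
  obtain ⟨x, hx⟩ := hb.exists
  have hM : 0 ≤ M := (abs_nonneg _).trans hx
  have hi : Integrable h μ := Integrable.of_bound hm M hb
  obtain ⟨g, -, hg, hgc, hgi⟩ := hi.exists_hasCompactSupport_integral_sub_le hε
  let F : C(PairSpace V, ℝ) := ⟨fun x => max (-M) (min M (g x)), by fun_prop⟩
  refine ⟨F, fun x => abs_clip_le hM _, le_trans ?_ hg⟩
  refine integral_mono_ae (hi.sub (integrable_continuousMap F)).abs (hi.sub hgi).norm ?_
  filter_upwards [hb] with x hx
  exact abs_sub_clip_le hx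

variable [∀ n, Fintype (V n)]

/-- Integrals against `μ` are the limits along `U` of the averages over the symmetric squares. -/
def IsLimitMeasure (U : Ultrafilter ℕ) (μ : Measure (PairSpace V)) : Prop :=
  ∀ F : C(PairSpace V, ℝ),
    Tendsto (fun n => ∫ p, F (embed n p) ∂uniform (V n)) U (𝓝 (∫ x, F x ∂μ))

theorem IsLimitMeasure.tendsto_integral_abs_sub {U : Ultrafilter ℕ}
    {μ : Measure (PairSpace V)} (hμ : IsLimitMeasure U μ)
    (F G : C(PairSpace V, ℝ)) :
    Tendsto (fun n => ∫ p, |F (embed n p) - G (embed n p)| ∂uniform (V n)) U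
      (𝓝 (∫ x, |F x - G x| ∂μ)) :=
  hμ ⟨fun x => |F x - G x|, by fun_prop⟩

variable [∀ n, Nonempty (V n)]

/-- The probability measures on a compact space form a compact space, so the pushed-forward uniform
measures converge along `U`. As `PairSpace V` is not metrizable, the limit is replaced by a regular
measure with the same integrals of continuous functions; regularity is needed for approximation in
$L^1$ by continuous functions. -/
theorem exists_isLimitMeasure (U : Ultrafilter ℕ) :
    ∃ μ : Measure (PairSpace V), IsProbabilityMeasure μ ∧ μ.Regular ∧ IsLimitMeasure U μ := by
  let P : ℕ → ProbabilityMeasure (PairSpace V) := fun n =>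
    ⟨(uniform (V n)).map (embed n),
      Measure.isProbabilityMeasure_map (measurable_embed n).aemeasurable⟩
  obtain ⟨ν, -, hν⟩ := isCompact_univ.ultrafilter_le_nhds (U.map P) (by simp)
  have hν' : Tendsto P U (𝓝 ν) := hν
  obtain ⟨μ, hr, hf, h⟩ := Measure.exists_regular_eq_of_compactSpace (ν : Measure (PairSpace V))
  refine ⟨μ, ⟨?_⟩, hr, fun F => ?_⟩
  · have h1 := h (BoundedContinuousFunction.const _ 1)
    simp only [BoundedContinuousFunction.const_apply, integral_const, probReal_univ, smul_eq_mul,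
      mul_one] at h1
    rw [measureReal_def, eq_comm, ENNReal.toReal_eq_one_iff] at h1
    exact h1
  · have h1 := (ProbabilityMeasure.tendsto_iff_forall_integral_tendsto.1 hν')
      (BoundedContinuousFunction.mkOfCompact F)
    rw [h] at h1
    refine h1.congr fun n => ?_
    exact integral_map (measurable_embed n).aemeasurable F.continuous.aestronglyMeasurable

section Limit

variable {U : Ultrafilter ℕ} {μ : Measure (PairSpace V)} [IsProbabilityMeasure μ]

/-- Every bounded measurable function is almost everywhere equal to a continuous one. -/
theorem IsLimitMeasure.exists_continuousMap_ae_eq [μ.Regular] (hμ : IsLimitMeasure U μ)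
    (hU : (U : Filter ℕ) ≤ atTop) {h : PairSpace V → ℝ} (hm : AEStronglyMeasurable h μ) {M : ℝ}
    (hb : ∀ᵐ x ∂μ, |h x| ≤ M) :
    ∃ F : C(PairSpace V, ℝ), (∀ x, |F x| ≤ M) ∧ F =ᵐ[μ] h := by
  classical
  have hi : Integrable h μ := Integrable.of_bound hm M hb
  -- `G m` is continuous and within $2^{-m}$ of `h` in $L^1$. The representative `F` is glued
  -- diagonally, using `G (k n)` on level `n`, where `k n` tends to infinity along `U`.
  choose G hG hGh using fun m : ℕ =>
    exists_continuousMap_integral_abs_sub_le hm hb (pow_pos (half_pos one_pos) m : (0 : ℝ) < _)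
  let d : ℕ → ℕ → ℕ → ℝ := fun n l m =>
    ∫ p, |G l (embed n p) - G m (embed n p)| ∂uniform (V n)
  -- In the limit the distance of `G l` and `G m` is at most $2^{-l}+2^{-m}\le 2\cdot 2^{-m}$; the
  -- constant 3 leaves room for the bound to hold on `U`-almost every level.
  let X : ℕ → ℕ → Prop := fun l n => ∀ m ≤ l, d n l m ≤ 3 * (1 / 2) ^ m
  have hX : ∀ l, ∀ᶠ n in (U : Filter ℕ), X l n := by
    intro l
    refine (eventually_all_finite (Set.finite_Iic l)).2 fun m hm => ?_
    refine ((hμ.tendsto_integral_abs_sub (G l) (G m)).eventually (gt_mem_nhds ?_)).mono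
      fun n hn => hn.le
    have hpos : (0 : ℝ) < (1 / 2) ^ m := by positivity
    have hle : ((1 : ℝ) / 2) ^ l ≤ (1 / 2) ^ m :=
      pow_le_pow_of_le_one (by norm_num) (by norm_num) hm
    calc ∫ x, |G l x - G m x| ∂μ ≤ ∫ x, (|h x - G l x| + |h x - G m x|) ∂μ := by
          refine integral_mono
            ((integrable_continuousMap (G l)).sub (integrable_continuousMap (G m))).abs
            ((hi.sub (integrable_continuousMap _)).abs.add
              (hi.sub (integrable_continuousMap _)).abs) fun x => ?_
          have := abs_sub_le (G l x) (h x) (G m x)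
          rwa [abs_sub_comm (G l x) (h x)] at this
      _ = (∫ x, |h x - G l x| ∂μ) + ∫ x, |h x - G m x| ∂μ :=
          integral_add (hi.sub (integrable_continuousMap _)).abs
            (hi.sub (integrable_continuousMap _)).abs
      _ < 3 * (1 / 2) ^ m := by linarith [hGh l, hGh m]
  have hX0 : ∀ n, X 0 n := by
    intro n m hm
    obtain rfl : m = 0 := Nat.le_zero.1 hm
    simp [d]
  -- The largest `l ≤ n` for which level `n` is good; `hX0` ensures that the search always succeeds.
  let k : ℕ → ℕ := fun n => Nat.findGreatest (fun l => X l n) n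
  have hk : ∀ n, X (k n) n := fun n =>
    Nat.findGreatest_spec (P := fun l => X l n) (Nat.zero_le n) (hX0 n)
  obtain ⟨F, hF⟩ := exists_continuousMap_embed (f := fun n p => G (k n) (embed n p))
    (fun n => measurable_comp_embed _ n) (M := M) (fun n p => hG _ _)
  refine ⟨F, abs_le_of_forall_embed fun n p => by rw [hF]; exact hG _ _, ?_⟩
  have hFG : ∀ m, ∫ x, |F x - G m x| ∂μ ≤ 3 * (1 / 2) ^ m := by
    intro m
    refine le_of_tendsto (hμ.tendsto_integral_abs_sub F (G m)) ?_
    filter_upwards [hX m, hU (eventually_ge_atTop m)] with n hn hmn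
    simp only [hF]
    exact hk n m (Nat.le_findGreatest (P := fun l => X l n) hmn hn)
  have hFh : ∀ m : ℕ, ∫ x, |F x - h x| ∂μ ≤ 4 * (1 / 2) ^ m := by
    intro m
    calc ∫ x, |F x - h x| ∂μ ≤ ∫ x, (|F x - G m x| + |h x - G m x|) ∂μ := by
          refine integral_mono ((integrable_continuousMap F).sub hi).abs
            (((integrable_continuousMap F).sub (integrable_continuousMap _)).abs.add
              (hi.sub (integrable_continuousMap _)).abs) fun x => ?_
          have := abs_sub_le (F x) (G m x) (h x)
          rwa [abs_sub_comm (G m x)] at this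
      _ = (∫ x, |F x - G m x| ∂μ) + ∫ x, |h x - G m x| ∂μ :=
          integral_add ((integrable_continuousMap F).sub (integrable_continuousMap _)).abs
            (hi.sub (integrable_continuousMap _)).abs
      _ ≤ 4 * (1 / 2) ^ m := by linarith [hFG m, hGh m]
  have h0 : ∫ x, |F x - h x| ∂μ ≤ 0 := by
    refine ge_of_tendsto' (x := atTop) ?_ hFh
    simpa using (tendsto_pow_atTop_nhds_zero_of_lt_one (r := (1 / 2 : ℝ)) (by norm_num)
      (by norm_num)).const_mul 4
  have h1 := (integral_eq_zero_iff_of_nonneg (fun x => abs_nonneg (F x - h x))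
    ((integrable_continuousMap F).sub hi).abs).1
    (le_antisymm h0 (integral_nonneg fun x => abs_nonneg _))
  filter_upwards [h1] with x hx
  simpa [sub_eq_zero] using hx

end Limit

end Compactification

/-! ### The limit operator along an ultrafilter -/

section LimitOperator

theorem ae_abs_le_norm {α : Type u} [MeasurableSpace α] {μ : Measure α} (h : Lp ℝ ∞ μ) :
    ∀ᵐ x ∂μ, |h x| ≤ ‖h‖ := by
  have hfin : eLpNormEssSup h μ ≠ ∞ := by
    rw [← eLpNorm_exponent_top]
    exact (Lp.memLp h).2.ne
  filter_upwards [enorm_ae_le_eLpNormEssSup h μ] with p hp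
  rw [Lp.norm_def, eLpNorm_exponent_top, ← Real.norm_eq_abs, ← toReal_enorm]
  exact ENNReal.toReal_mono hfin hp

variable {V : ℕ → Type} [∀ n, Fintype (V n)] [∀ n, Nonempty (V n)]
  {T : ∀ n, Tensor 3 (V n)}

theorem exists_limitAction (hT : ∀ n, NormalizedTensor (T n)) (F G : C(PairSpace V, ℝ)) :
    ∃ H : C(PairSpace V, ℝ), ∀ n p, H (embed n p) =
      twoActionFun (T n) (fun q => F (embed n q)) (fun q => G (embed n q)) p :=
  exists_continuousMap_embed (fun _ => measurable_twoActionFun _ _ _) (M := ‖F‖ * ‖G‖)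
    fun n p => (hT n).abs_twoActionFun_le_mul (fun _ => F.norm_coe_le_norm _)
      (fun _ => G.norm_coe_le_norm _) p

/-- The extension of the sequence of `2`-actions of `T n` to continuous functions. -/
def limitAction (hT : ∀ n, NormalizedTensor (T n)) (F G : C(PairSpace V, ℝ)) :
    C(PairSpace V, ℝ) :=
  (exists_limitAction hT F G).choose

variable (hT : ∀ n, NormalizedTensor (T n))

theorem limitAction_embed (F G : C(PairSpace V, ℝ)) (n : ℕ) (p : SymSquare (V n)) :
    limitAction hT F G (embed n p) =
      twoActionFun (T n) (fun q => F (embed n q)) (fun q => G (embed n q)) p :=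
  (exists_limitAction hT F G).choose_spec n p

theorem limitAction_add_left (F F' G : C(PairSpace V, ℝ)) :
    limitAction hT (F + F') G = limitAction hT F G + limitAction hT F' G :=
  continuousMap_ext_embed fun n p => by
    simp only [limitAction_embed, ContinuousMap.add_apply, twoActionFun_add_left]

theorem limitAction_add_right (F G G' : C(PairSpace V, ℝ)) :
    limitAction hT F (G + G') = limitAction hT F G + limitAction hT F G' :=
  continuousMap_ext_embed fun n p => by
    simp only [limitAction_embed, ContinuousMap.add_apply, twoActionFun_add_right]

theorem limitAction_smul_left (c : ℝ) (F G : C(PairSpace V, ℝ)) :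
    limitAction hT (c • F) G = c • limitAction hT F G :=
  continuousMap_ext_embed fun n p => by
    simp only [limitAction_embed, ContinuousMap.smul_apply, smul_eq_mul, twoActionFun_smul_left]

theorem limitAction_smul_right (c : ℝ) (F G : C(PairSpace V, ℝ)) :
    limitAction hT F (c • G) = c • limitAction hT F G :=
  continuousMap_ext_embed fun n p => by
    simp only [limitAction_embed, ContinuousMap.smul_apply, smul_eq_mul, twoActionFun_smul_right]

theorem abs_limitAction_le {F G : C(PairSpace V, ℝ)} {a b : ℝ} (hF : ∀ x, |F x| ≤ a)
    (hG : ∀ x, |G x| ≤ b) (x : PairSpace V) : |limitAction hT F G x| ≤ a * b :=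
  abs_le_of_forall_embed (fun n p => by
    rw [limitAction_embed]
    exact (hT n).abs_twoActionFun_le_mul (fun _ => hF _) (fun _ => hG _) p) x

variable {U : Ultrafilter ℕ} {μ : Measure (PairSpace V)} [IsProbabilityMeasure μ]

/-- An $L^1$ bound that holds on every level with the same constant passes to the limit along `U`,
because `|F|` and `|H|` are again continuous. -/
theorem ae_eq_zero_of_tendsto_zero (hμ : IsLimitMeasure U μ) (F : C(PairSpace V, ℝ)) (b : ℝ)
    (H : C(PairSpace V, ℝ)) (hF : F =ᵐ[μ] 0)
    (hb : ∀ n, ∫ p, |H (embed n p)| ∂uniform (V n) ≤ b * ∫ p, |F (embed n p)| ∂uniform (V n)) :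
    H =ᵐ[μ] 0 := by
  have hF0 := hμ.tendsto_integral_abs_sub F 0
  have hH := hμ.tendsto_integral_abs_sub H 0
  simp only [ContinuousMap.zero_apply, sub_zero] at hF0 hH
  have e : ∫ x, |F x| ∂μ = 0 := by
    rw [integral_eq_zero_iff_of_nonneg (fun x => abs_nonneg (F x))
      (integrable_continuousMap F).abs]
    filter_upwards [hF] with x hx
    simpa using hx
  rw [e] at hF0
  have h1 : ∫ x, |H x| ∂μ ≤ b * 0 := le_of_tendsto_of_tendsto' hH (hF0.const_mul b) hb
  rw [mul_zero] at h1
  have h2 := (integral_eq_zero_iff_of_nonneg (fun x => abs_nonneg (H x))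
    (integrable_continuousMap H).abs).1 (le_antisymm h1 (integral_nonneg fun x => abs_nonneg _))
  filter_upwards [h2] with x hx
  simpa using hx

theorem limitAction_ae_eq_zero_left (hμ : IsLimitMeasure U μ) {F : C(PairSpace V, ℝ)}
    (hF : F =ᵐ[μ] 0) (G : C(PairSpace V, ℝ)) : limitAction hT F G =ᵐ[μ] 0 :=
  ae_eq_zero_of_tendsto_zero hμ F ‖G‖ _ hF fun n => by
    simp only [limitAction_embed]
    exact (hT n).integral_abs_twoActionFun_le_left (measurable_comp_embed F n)
      fun _ => G.norm_coe_le_norm _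

theorem limitAction_ae_eq_zero_right (hμ : IsLimitMeasure U μ) (F : C(PairSpace V, ℝ))
    {G : C(PairSpace V, ℝ)} (hG : G =ᵐ[μ] 0) : limitAction hT F G =ᵐ[μ] 0 :=
  ae_eq_zero_of_tendsto_zero hμ G ‖F‖ _ hG fun n => by
    simp only [limitAction_embed]
    exact (hT n).integral_abs_twoActionFun_le_right (measurable_comp_embed G n)
      fun _ => F.norm_coe_le_norm _

/-- By bilinearity the difference is the action on $(F-F',G)$ plus the action on $(F',G-G')$, and
both vanish almost everywhere. This is what allows the action to descend to $L^\infty(\mu)$. -/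
theorem limitAction_congr (hμ : IsLimitMeasure U μ) {F F' G G' : C(PairSpace V, ℝ)}
    (hF : F =ᵐ[μ] F') (hG : G =ᵐ[μ] G') : limitAction hT F G =ᵐ[μ] limitAction hT F' G' := by
  have h1 := limitAction_ae_eq_zero_left hT hμ (F := F - F') (by
    filter_upwards [hF] with x hx
    simp [hx]) G
  have h2 := limitAction_ae_eq_zero_right hT hμ F' (G := G - G') (by
    filter_upwards [hG] with x hx
    simp [hx])
  have e : limitAction hT F G =
      limitAction hT (F - F') G + limitAction hT F' (G - G') + limitAction hT F' G' := by
    rw [add_assoc, ← limitAction_add_right, sub_add_cancel, ← limitAction_add_left,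
      sub_add_cancel]
  rw [e]
  filter_upwards [h1, h2] with x hx1 hx2
  simp only [Pi.zero_apply] at hx1 hx2
  simp [hx1, hx2]

variable [μ.Regular]

theorem IsLimitMeasure.exists_lift (hμ : IsLimitMeasure U μ) (hU : (U : Filter ℕ) ≤ atTop)
    (h : Lp ℝ ∞ μ) : ∃ F : C(PairSpace V, ℝ), (∀ x, |F x| ≤ ‖h‖) ∧ F =ᵐ[μ] h :=
  hμ.exists_continuousMap_ae_eq hU (Lp.stronglyMeasurable h).aestronglyMeasurable
    (ae_abs_le_norm h)

/-- A continuous representative of an essentially bounded function. -/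
def IsLimitMeasure.lift (hμ : IsLimitMeasure U μ) (hU : (U : Filter ℕ) ≤ atTop)
    (h : Lp ℝ ∞ μ) : C(PairSpace V, ℝ) :=
  (hμ.exists_lift hU h).choose

variable (hμ : IsLimitMeasure U μ) (hU : (U : Filter ℕ) ≤ atTop)

theorem IsLimitMeasure.abs_lift_le (h : Lp ℝ ∞ μ) (x : PairSpace V) : |hμ.lift hU h x| ≤ ‖h‖ :=
  (hμ.exists_lift hU h).choose_spec.1 x

theorem IsLimitMeasure.lift_ae_eq (h : Lp ℝ ∞ μ) : hμ.lift hU h =ᵐ[μ] h :=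
  (hμ.exists_lift hU h).choose_spec.2

/-- The chosen representatives are additive only up to null sets, which is enough because the action
ignores null sets. -/
theorem IsLimitMeasure.lift_add_ae_eq (h h' : Lp ℝ ∞ μ) :
    hμ.lift hU (h + h') =ᵐ[μ] (hμ.lift hU h + hμ.lift hU h' : C(PairSpace V, ℝ)) := by
  filter_upwards [hμ.lift_ae_eq hU h, hμ.lift_ae_eq hU h', hμ.lift_ae_eq hU (h + h'),
    Lp.coeFn_add h h'] with x h1 h2 h3 h4
  rw [h3, h4]
  simp [h1, h2]

theorem IsLimitMeasure.lift_smul_ae_eq (c : ℝ) (h : Lp ℝ ∞ μ) :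
    hμ.lift hU (c • h) =ᵐ[μ] (c • hμ.lift hU h : C(PairSpace V, ℝ)) := by
  filter_upwards [hμ.lift_ae_eq hU h, hμ.lift_ae_eq hU (c • h),
    Lp.coeFn_smul c h] with x h1 h2 h3
  simp [h1, h2, h3]

/-- The limit operator on essentially bounded functions. -/
def limitLpAction (f g : Lp ℝ ∞ μ) : Lp ℝ 1 μ :=
  ContinuousMap.toLp 1 μ ℝ (limitAction hT (hμ.lift hU f) (hμ.lift hU g))

theorem toLp_limitAction_congr (hμ : IsLimitMeasure U μ) {F F' G G' : C(PairSpace V, ℝ)}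
    (hF : F =ᵐ[μ] F') (hG : G =ᵐ[μ] G') :
    ContinuousMap.toLp 1 μ ℝ (limitAction hT F G) =
      ContinuousMap.toLp 1 μ ℝ (limitAction hT F' G') :=
  Lp.ext ((ContinuousMap.coeFn_toLp μ _).trans
    ((limitAction_congr hT hμ hF hG).trans (ContinuousMap.coeFn_toLp μ _).symm))

theorem limitLpAction_add_left (f f' g : Lp ℝ ∞ μ) : limitLpAction hT hμ hU (f + f') g =
    limitLpAction hT hμ hU f g + limitLpAction hT hμ hU f' g := by
  rw [limitLpAction, toLp_limitAction_congr hT hμ (hμ.lift_add_ae_eq hU f f') (ae_eq_refl _),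
    limitAction_add_left, map_add]
  rfl

theorem limitLpAction_add_right (f g g' : Lp ℝ ∞ μ) : limitLpAction hT hμ hU f (g + g') =
    limitLpAction hT hμ hU f g + limitLpAction hT hμ hU f g' := by
  rw [limitLpAction, toLp_limitAction_congr hT hμ (ae_eq_refl _) (hμ.lift_add_ae_eq hU g g'),
    limitAction_add_right, map_add]
  rfl

theorem limitLpAction_smul_left (c : ℝ) (f g : Lp ℝ ∞ μ) :
    limitLpAction hT hμ hU (c • f) g = c • limitLpAction hT hμ hU f g := by
  rw [limitLpAction, toLp_limitAction_congr hT hμ (hμ.lift_smul_ae_eq hU c f) (ae_eq_refl _),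
    limitAction_smul_left, map_smul]
  rfl

theorem limitLpAction_smul_right (c : ℝ) (f g : Lp ℝ ∞ μ) :
    limitLpAction hT hμ hU f (c • g) = c • limitLpAction hT hμ hU f g := by
  rw [limitLpAction, toLp_limitAction_congr hT hμ (ae_eq_refl _) (hμ.lift_smul_ae_eq hU c g),
    limitAction_smul_right, map_smul]
  rfl

theorem norm_limitLpAction_le (f g : Lp ℝ ∞ μ) :
    ‖limitLpAction hT hμ hU f g‖ ≤ ‖f‖ * ‖g‖ := by
  have h := Lp.norm_le_of_ae_bound (f := limitLpAction hT hμ hU f g) (C := ‖f‖ * ‖g‖)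
    (by positivity) (by
      filter_upwards [ContinuousMap.coeFn_toLp (p := 1) (𝕜 := ℝ) μ
        (limitAction hT (hμ.lift hU f) (hμ.lift hU g))] with x hx
      rw [limitLpAction, hx]
      exact abs_limitAction_le hT (hμ.abs_lift_le hU f) (hμ.abs_lift_le hU g) x)
  have hu : measureUnivNNReal μ = 1 := by simp [measureUnivNNReal]
  simpa [hu] using h

/-- The limit of the multi-`P`-operators of the tensors `T n` along an ultrafilter. -/
def limitOperator : MultiPOperator.{0} 2 where
  Ω := PairSpace V
  μ := μ
  op := MultilinearMap.mkContinuous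
    { toFun := fun f => limitLpAction hT hμ hU (f 0) (f 1)
      map_update_add' := by
        intro _ f a x y
        fin_cases a
        · simpa using limitLpAction_add_left hT hμ hU x y (f 1)
        · simpa using limitLpAction_add_right hT hμ hU (f 0) x y
      map_update_smul' := by
        intro _ f a c x
        fin_cases a
        · simpa using limitLpAction_smul_left hT hμ hU c x (f 1)
        · simpa using limitLpAction_smul_right hT hμ hU c (f 0) x } 1 fun f => by
      simpa [Fin.prod_univ_two] using norm_limitLpAction_le hT hμ hU (f 0) (f 1)

/-- Any continuous representatives compute the operator, not only those selected by `lift`. -/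
theorem limitOperator_op_ae_eq {f : Fin 2 → Lp ℝ ∞ μ} {F : Fin 2 → C(PairSpace V, ℝ)}
    (hF : ∀ j, F j =ᵐ[μ] f j) :
    (limitOperator hT hμ hU).op f =ᵐ[μ] limitAction hT (F 0) (F 1) :=
  (ContinuousMap.coeFn_toLp μ _).trans (limitAction_congr hT hμ
    ((hμ.lift_ae_eq hU _).trans (hF 0).symm) ((hμ.lift_ae_eq hU _).trans (hF 1).symm))

end LimitOperator

/-! ### Profiles of the limit operator -/

theorem MultiPOperator.integral_law {m : ℕ} (A : MultiPOperator.{u} m) {k : ℕ}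
    (f : Fin k → Fin m → Lp ℝ ∞ A.μ) (ψ : BoundedContinuousFunction (ProfileSpace m k) ℝ) :
    ∫ x, ψ x ∂(A.law f : Measure (ProfileSpace m k)) = ∫ ω, ψ (A.randomVector f ω) ∂A.μ :=
  integral_map (A.measurable_randomVector f).aemeasurable ψ.continuous.aestronglyMeasurable

theorem MultiPOperator.profile_nonempty {m : ℕ} (A : MultiPOperator.{u} m) (k : ℕ) :
    (A.profile k).Nonempty :=
  ⟨_, fun _ _ => 0, fun _ _ => by
    filter_upwards [Lp.coeFn_zero ℝ ∞ A.μ] with x hx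
    rw [hx]
    simp, rfl⟩

/-- The points of the profile space with all coordinates in `[-1, 1]`. -/
def profileCube (m k : ℕ) : Set (ProfileSpace m k) := {x | ∀ q, |x q| ≤ 1}

theorem isCompact_profileCube (m k : ℕ) : IsCompact (profileCube m k) := by
  have h : IsCompact (Set.pi Set.univ fun _ : Fin k × Fin (m + 1) => Set.Icc (-1 : ℝ) 1) :=
    isCompact_univ_pi fun _ => isCompact_Icc
  convert h.image (PiLp.continuous_toLp 2 fun _ : Fin k × Fin (m + 1) => ℝ) using 1
  ext x
  constructor
  · intro hx
    exact ⟨fun q => x q, fun q _ => abs_le.1 (hx q), rfl⟩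
  · rintro ⟨y, hy, rfl⟩ q
    exact abs_le.2 (hy q trivial)

/-- Measures carried by one compact set are tight, so Prokhorov's theorem applies; the tightness
criterion is used with a constant compact set and the error bound `0`. -/
theorem isCompact_supported_profileCube (m k : ℕ) :
    IsCompact {ν : LevyProkhorov (ProbabilityMeasure (ProfileSpace m k)) |
      (ν.toMeasure : Measure (ProfileSpace m k)) (profileCube m k)ᶜ = 0} := by
  have h := isCompact_setOfPred_probabilityMeasure_mass_eq_compl_isCompact_le
    (E := ProfileSpace m k) (u := fun _ => 0) (K := fun _ => profileCube m k) tendsto_const_nhds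
    (fun _ => isCompact_profileCube m k) (Or.inr monotone_const)
  convert (LevyProkhorov.probabilityMeasureHomeomorph (Ω := ProfileSpace m k)).isCompact_image.2 h
    using 1
  ext ν
  constructor
  · intro hν
    refine ⟨ν.toMeasure, fun _ => ?_, rfl⟩
    rw [nonpos_iff_eq_zero, ProbabilityMeasure.null_iff_toMeasure_null]
    exact hν
  · rintro ⟨ρ, hρ, rfl⟩
    have := hρ 0
    rw [nonpos_iff_eq_zero, ProbabilityMeasure.null_iff_toMeasure_null] at this
    exact this

section LimitProfile

variable {V : ℕ → Type} [∀ n, Fintype (V n)] [∀ n, Nonempty (V n)]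
  {T : ∀ n, Tensor 3 (V n)} (hT : ∀ n, NormalizedTensor (T n))

/-- The random vector of the limit operator for continuous functions. -/
def limitVector {k : ℕ} (F : Fin k → Fin 2 → C(PairSpace V, ℝ)) (x : PairSpace V) :
    ProfileSpace 2 k :=
  WithLp.toLp 2 fun q : Fin k × Fin 3 =>
    (Fin.snoc (fun j : Fin 2 => F q.1 j x) (limitAction hT (F q.1 0) (F q.1 1) x) :
      Fin 3 → ℝ) q.2

theorem continuous_limitVector {k : ℕ} (F : Fin k → Fin 2 → C(PairSpace V, ℝ)) :
    Continuous (limitVector hT F) := by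
  refine (PiLp.continuous_toLp 2 _).comp (continuous_pi ?_)
  rintro ⟨a, b⟩
  refine Fin.lastCases ?_ (fun j => ?_) b
  · simp only [Fin.snoc_last]
    exact (limitAction hT (F a 0) (F a 1)).continuous
  · simp only [Fin.snoc_castSucc]
    exact (F a j).continuous

theorem limitVector_mem_profileCube {k : ℕ} {F : Fin k → Fin 2 → C(PairSpace V, ℝ)}
    (hF : ∀ a j x, |F a j x| ≤ 1) (x : PairSpace V) : limitVector hT F x ∈ profileCube 2 k := by
  rintro ⟨a, b⟩
  refine Fin.lastCases ?_ (fun j => ?_) b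
  · simp only [limitVector, Fin.snoc_last]
    simpa using abs_limitAction_le hT (hF a 0) (hF a 1) x
  · simp only [limitVector, Fin.snoc_castSucc]
    exact hF a j x

theorem randomVector_twoAction {k n : ℕ} {F : Fin k → Fin 2 → C(PairSpace V, ℝ)}
    {f : Fin k → Fin 2 → Lp ℝ ∞ (uniform (V n))} (hf : ∀ a j p, f a j p = F a j (embed n p))
    (p : SymSquare (V n)) :
    (twoAction (T n)).randomVector f p = limitVector hT F (embed n p) := by
  have hf' : ∀ a j, ⇑(f a j) = fun p => F a j (embed n p) := fun a j => funext (hf a j)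
  refine congrArg (WithLp.toLp 2) (funext ?_)
  rintro ⟨a, b⟩
  refine Fin.lastCases ?_ (fun j => ?_) b
  · simp only [Fin.snoc_last]
    rw [limitAction_embed, ← hf', ← hf', ← coe_op_twoAction]
  · simp only [Fin.snoc_castSucc]
    exact hf a j p

variable {U : Ultrafilter ℕ} {μ : Measure (PairSpace V)} [IsProbabilityMeasure μ] [μ.Regular]
  (hμ : IsLimitMeasure U μ) (hU : (U : Filter ℕ) ≤ atTop)

theorem randomVector_limitOperator {k : ℕ} {F : Fin k → Fin 2 → C(PairSpace V, ℝ)}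
    {g : Fin k → Fin 2 → Lp ℝ ∞ μ} (hg : ∀ a j, F a j =ᵐ[μ] g a j) :
    (limitOperator hT hμ hU).randomVector g =ᵐ[μ] limitVector hT F := by
  have h1 : ∀ᵐ x ∂μ, ∀ a j, F a j x = g a j x := by
    rw [ae_all_iff]
    intro a
    rw [ae_all_iff]
    exact hg a
  have h2 : ∀ᵐ x ∂μ, ∀ a, (limitOperator hT hμ hU).op (g a) x =
      limitAction hT (F a 0) (F a 1) x :=
    ae_all_iff.2 fun a => limitOperator_op_ae_eq hT hμ hU (hg a)
  filter_upwards [h1, h2] with x hx1 hx2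
  refine congrArg (WithLp.toLp 2) (funext ?_)
  rintro ⟨a, b⟩
  refine Fin.lastCases ?_ (fun j => ?_) b
  · simp only [Fin.snoc_last]
    exact hx2 a
  · simp only [Fin.snoc_castSucc]
    exact (hx1 a j).symm

theorem integral_law_limitOperator {k : ℕ} {F : Fin k → Fin 2 → C(PairSpace V, ℝ)}
    {g : Fin k → Fin 2 → Lp ℝ ∞ μ} (hg : ∀ a j, F a j =ᵐ[μ] g a j)
    (ψ : BoundedContinuousFunction (ProfileSpace 2 k) ℝ) :
    ∫ y, ψ y ∂((limitOperator hT hμ hU).law g : Measure (ProfileSpace 2 k)) =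
      ∫ x, ψ (limitVector hT F x) ∂μ := by
  refine (MultiPOperator.integral_law (limitOperator hT hμ hU) g ψ).trans (integral_congr_ae ?_)
  filter_upwards [randomVector_limitOperator hT hμ hU hg] with x hx
  exact congrArg ψ hx

theorem integral_law_twoAction {k n : ℕ} {F : Fin k → Fin 2 → C(PairSpace V, ℝ)}
    {f : Fin k → Fin 2 → Lp ℝ ∞ (uniform (V n))} (hf : ∀ a j p, f a j p = F a j (embed n p))
    (ψ : BoundedContinuousFunction (ProfileSpace 2 k) ℝ) :
    ∫ y, ψ y ∂((twoAction (T n)).law f : Measure (ProfileSpace 2 k)) =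
      ∫ p, ψ (limitVector hT F (embed n p)) ∂uniform (V n) := by
  refine (MultiPOperator.integral_law (twoAction (T n)) f ψ).trans (integral_congr_ae ?_)
  exact Eventually.of_forall fun p => congrArg ψ (randomVector_twoAction hT hf p)

/-- A test function composed with `limitVector` is a continuous function on the compact space, so
the defining property of the limit measure is already the weak convergence. -/
theorem tendsto_law_twoAction {k : ℕ} {F : Fin k → Fin 2 → C(PairSpace V, ℝ)}
    {f : ∀ n, Fin k → Fin 2 → Lp ℝ ∞ (uniform (V n))} {g : Fin k → Fin 2 → Lp ℝ ∞ μ}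
    (hf : ∀ n a j p, f n a j p = F a j (embed n p)) (hg : ∀ a j, F a j =ᵐ[μ] g a j) :
    Tendsto (fun n => LevyProkhorov.ofMeasure ((twoAction (T n)).law (f n))) U
      (𝓝 (LevyProkhorov.ofMeasure ((limitOperator hT hμ hU).law g))) := by
  have hlim : Tendsto (fun n => (twoAction (T n)).law (f n)) U
      (𝓝 ((limitOperator hT hμ hU).law g)) := by
    refine ProbabilityMeasure.tendsto_iff_forall_integral_tendsto.2 fun ψ => ?_
    have h : Tendsto (fun n => ∫ p, ψ (limitVector hT F (embed n p)) ∂uniform (V n)) U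
        (𝓝 (∫ x, ψ (limitVector hT F x) ∂μ)) :=
      hμ ⟨fun x => ψ (limitVector hT F x), ψ.continuous.comp (continuous_limitVector hT F)⟩
    have h2 := h.congr fun n => (integral_law_twoAction hT (hf n) ψ).symm
    exact h2.trans (le_of_eq (congrArg 𝓝 (integral_law_limitOperator hT hμ hU hg ψ).symm))
  exact (LevyProkhorov.continuous_ofMeasure_probabilityMeasure.tendsto _).comp hlim

/-- Every profile element of the limit operator is a limit of profile elements. -/
theorem exists_tendsto_of_mem_profile {k : ℕ}
    {ν : LevyProkhorov (ProbabilityMeasure (ProfileSpace 2 k))}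
    (hν : ν ∈ (limitOperator hT hμ hU).profile k) :
    ∃ ρ : ℕ → LevyProkhorov (ProbabilityMeasure (ProfileSpace 2 k)),
      (∀ n, ρ n ∈ (twoAction (T n)).profile k) ∧ Tendsto ρ U (𝓝 ν) := by
  obtain ⟨g, hg, rfl⟩ := hν
  have hex : ∀ a j, ∃ F : C(PairSpace V, ℝ), (∀ x, |F x| ≤ 1) ∧ F =ᵐ[μ] g a j := fun a j =>
    hμ.exists_continuousMap_ae_eq hU (Lp.stronglyMeasurable (g a j)).aestronglyMeasurable
      ((hg a j).mono fun x hx => abs_le.2 hx)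
  -- Continuous representatives with the same bound restrict to admissible inputs on every level.
  choose F hF1 hF using hex
  have hm : ∀ n a j, MemLp (fun p => F a j (embed n p)) ∞ (uniform (V n)) := fun n a j =>
    memLp_uniform (measurable_comp_embed _ n) _
  have hc : ∀ n a j p, (hm n a j).toLp _ p = F a j (embed n p) := fun n a j p =>
    congrFun (coe_toLp_uniform (hm n a j)) p
  refine ⟨_, fun n => ⟨fun a j => (hm n a j).toLp _, fun a j => ?_, rfl⟩,
    tendsto_law_twoAction hT hμ hU hc hF⟩
  refine Eventually.of_forall fun p => ?_
  have h := hF1 a j (embed n p)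
  rw [← hc n a j p] at h
  exact abs_le.1 h

/-- Every sequence of profile elements converges to a profile element of the limit operator. -/
theorem exists_mem_profile_tendsto {k : ℕ}
    {ρ : ℕ → LevyProkhorov (ProbabilityMeasure (ProfileSpace 2 k))}
    (hρ : ∀ n, ρ n ∈ (twoAction (T n)).profile k) :
    ∃ ν ∈ (limitOperator hT hμ hU).profile k, Tendsto ρ U (𝓝 ν) := by
  choose f hf hfρ using hρ
  have hf' : ∀ n a j p, |f n a j p| ≤ 1 := fun n a j p =>
    abs_le.2 ((ae_uniform_iff _).1 (hf n a j) p)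
  have hex : ∀ a j, ∃ F : C(PairSpace V, ℝ), ∀ n p, F (embed n p) = f n a j p := fun a j =>
    exists_continuousMap_embed (fun n => measurable_coe_lp (f n a j)) (fun n => hf' n a j)
  -- Conversely, arbitrary admissible inputs on the levels are glued to one continuous function for
  -- each slot.
  choose F hF using hex
  have hF1 : ∀ a j x, |F a j x| ≤ 1 := fun a j =>
    abs_le_of_forall_embed fun n p => by rw [hF]; exact hf' n a j p
  have hg : ∀ a j, F a j =ᵐ[μ] ContinuousMap.toLp ∞ μ ℝ (F a j) := fun a j =>
    (ContinuousMap.coeFn_toLp μ _).symm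
  refine ⟨LevyProkhorov.ofMeasure ((limitOperator hT hμ hU).law
    fun a j => ContinuousMap.toLp ∞ μ ℝ (F a j)), ⟨_, fun a j => ?_, rfl⟩, ?_⟩
  · refine Filter.Eventually.mono (hg a j) fun x hx => ?_
    have h := hF1 a j x
    rw [hx] at h
    exact abs_le.1 h
  · have h := tendsto_law_twoAction hT hμ hU (f := f)
      (fun n a j p => (hF a j n p).symm) hg
    exact h.congr fun n => (hfρ n).symm

theorem profile_limitOperator_subset (k : ℕ) : (limitOperator hT hμ hU).profile k ⊆
    {ν | (ν.toMeasure : Measure (ProfileSpace 2 k)) (profileCube 2 k)ᶜ = 0} := by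
  rintro _ ⟨g, hg, rfl⟩
  have hex : ∀ a j, ∃ F : C(PairSpace V, ℝ), (∀ x, |F x| ≤ 1) ∧ F =ᵐ[μ] g a j := fun a j =>
    hμ.exists_continuousMap_ae_eq hU (Lp.stronglyMeasurable (g a j)).aestronglyMeasurable
      ((hg a j).mono fun x hx => abs_le.2 hx)
  choose F hF1 hF using hex
  have h : ∀ᵐ x ∂μ, (limitOperator hT hμ hU).randomVector g x ∈ profileCube 2 k :=
    (randomVector_limitOperator hT hμ hU hF).mono fun x hx =>
      hx ▸ limitVector_mem_profileCube hT hF1 x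
  exact (Measure.map_apply ((limitOperator hT hμ hU).measurable_randomVector g)
    (isCompact_profileCube 2 k).measurableSet.compl).trans (ae_iff.1 h)

/-- If the distance stayed above `ε` on `U`-many levels, one of the two one-sided distances would do
so, since `U` is an ultrafilter. A bad sequence in the finite profiles converges to an element of
the limit profile, a contradiction. A bad sequence in the limit profile is handled by compactness
and an `ε / 3` argument. -/
theorem tendsto_hausdorffEDist_limitOperator (k : ℕ) :
    Tendsto (fun n => Metric.hausdorffEDist ((twoAction (T n)).profile k)
      ((limitOperator hT hμ hU).profile k)) U (𝓝 0) := by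
  rw [ENNReal.tendsto_nhds_zero]
  intro ε hε
  by_contra hcon
  rw [← Ultrafilter.eventually_not] at hcon
  have hsplit : ∀ᶠ n in (U : Filter ℕ),
      (∃ ν ∈ (twoAction (T n)).profile k, ∀ ρ ∈ (limitOperator hT hμ hU).profile k,
        ε < edist ν ρ) ∨
      (∃ ν ∈ (limitOperator hT hμ hU).profile k, ∀ ρ ∈ (twoAction (T n)).profile k,
        ε < edist ν ρ) := by
    filter_upwards [hcon] with n hn
    by_contra hno
    push Not at hno
    exact hn (Metric.hausdorffEDist_le_of_mem_edist hno.1 hno.2)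
  rcases Ultrafilter.eventually_or.1 hsplit with h | h
  · have hch : ∀ n, ∃ ν ∈ (twoAction (T n)).profile k,
        (∃ ν ∈ (twoAction (T n)).profile k, ∀ ρ ∈ (limitOperator hT hμ hU).profile k,
          ε < edist ν ρ) → ∀ ρ ∈ (limitOperator hT hμ hU).profile k, ε < edist ν ρ := by
      intro n
      by_cases hn : ∃ ν ∈ (twoAction (T n)).profile k,
        ∀ ρ ∈ (limitOperator hT hμ hU).profile k, ε < edist ν ρ
      · obtain ⟨ν, hν, h'⟩ := hn
        exact ⟨ν, hν, fun _ => h'⟩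
      · obtain ⟨ν, hν⟩ := (twoAction (T n)).profile_nonempty k
        exact ⟨ν, hν, fun h' => absurd h' hn⟩
    choose ρ hρ hρ' using hch
    obtain ⟨ν, hν, hlim⟩ := exists_mem_profile_tendsto hT hμ hU hρ
    have h1 := hlim.eventually (Metric.eball_mem_nhds ν hε)
    obtain ⟨n, hn, hn'⟩ := (h.and h1).exists
    exact absurd (hρ' n hn ν hν) (not_lt.2 (le_of_lt hn'))
  · have hch : ∀ n, ∃ ν : LevyProkhorov (ProbabilityMeasure (ProfileSpace 2 k)),
        (∃ ν ∈ (limitOperator hT hμ hU).profile k, ∀ ρ ∈ (twoAction (T n)).profile k,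
          ε < edist ν ρ) → ν ∈ (limitOperator hT hμ hU).profile k ∧
            ∀ ρ ∈ (twoAction (T n)).profile k, ε < edist ν ρ := by
      intro n
      by_cases hn : ∃ ν ∈ (limitOperator hT hμ hU).profile k,
        ∀ ρ ∈ (twoAction (T n)).profile k, ε < edist ν ρ
      · obtain ⟨ν, hν, h'⟩ := hn
        exact ⟨ν, fun _ => ⟨hν, h'⟩⟩
      -- An arbitrary value on the levels that are not bad.
      · exact ⟨⟨⟨Measure.dirac 0, inferInstance⟩⟩, fun h' => absurd h' hn⟩
    choose ρ hρ using hch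
    have hmem : ∀ᶠ n in (U : Filter ℕ), ρ n ∈ {ν : LevyProkhorov (ProbabilityMeasure (ProfileSpace 2 k)) |
        (ν.toMeasure : Measure (ProfileSpace 2 k)) (profileCube 2 k)ᶜ = 0} :=
      h.mono fun n hn => profile_limitOperator_subset hT hμ hU k (hρ n hn).1
    -- The limit `ν` is not known to lie in the limit profile. Hence one `ρ m` near `ν` is fixed and
    -- approximated by elements `σ n` of the finite profiles; for suitable `n` the chain `ρ n`, `ν`,
    -- `ρ m`, `σ n` contradicts badness.
    obtain ⟨ν, -, hν⟩ := (isCompact_supported_profileCube 2 k).ultrafilter_le_nhds (U.map ρ)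
      (le_principal_iff.2 hmem)
    have hlim : Tendsto ρ U (𝓝 ν) := hν
    have hε3 : 0 < ε / 3 := ENNReal.div_pos hε.ne' (by simp)
    have h1 := hlim.eventually (Metric.eball_mem_nhds ν hε3)
    obtain ⟨m, hm, hm'⟩ := (h.and h1).exists
    obtain ⟨σ, hσ, hσlim⟩ := exists_tendsto_of_mem_profile hT hμ hU (hρ m hm).1
    have h2 := hσlim.eventually (Metric.eball_mem_nhds (ρ m) hε3)
    obtain ⟨n, ⟨hn, hn1⟩, hn2⟩ := ((h.and h1).and h2).exists
    refine absurd ((hρ n hn).2 (σ n) (hσ n)) (not_lt.2 ?_)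
    have a1 : edist (ρ n) ν ≤ ε / 3 := le_of_lt hn1
    have a2 : edist ν (ρ m) ≤ ε / 3 := by
      rw [edist_comm]
      exact le_of_lt hm'
    have a3 : edist (ρ m) (σ n) ≤ ε / 3 := by
      rw [edist_comm]
      exact le_of_lt hn2
    calc edist (ρ n) (σ n) ≤ edist (ρ n) ν + edist ν (ρ m) + edist (ρ m) (σ n) :=
          edist_triangle4 _ _ _ _
      _ ≤ ε / 3 + ε / 3 + ε / 3 := add_le_add (add_le_add a1 a2) a3
      _ = ε := ENNReal.add_thirds ε

end LimitProfile

/-! ### Compactness -/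

theorem MultiPOperator.hausdorffEDist_profile_le_one {m : ℕ} (A : MultiPOperator.{u} m)
    (B : MultiPOperator.{v} m) (k : ℕ) :
    Metric.hausdorffEDist (A.profile k) (B.profile k) ≤ 1 := by
  have h : ∀ ν ρ : LevyProkhorov (ProbabilityMeasure (ProfileSpace m k)), edist ν ρ ≤ 1 := by
    intro ν ρ
    refine (levyProkhorovEDist_le_max_measure_univ _ _).trans ?_
    simp
  obtain ⟨a, ha⟩ := A.profile_nonempty k
  obtain ⟨b, hb⟩ := B.profile_nonempty k
  exact Metric.hausdorffEDist_le_of_mem_edist (fun _ _ => ⟨b, hb, h _ _⟩)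
    (fun _ _ => ⟨a, ha, h _ _⟩)

theorem MultiPOperator.actionDist_triangle {m : ℕ} (A : MultiPOperator.{u} m)
    (B : MultiPOperator.{v} m) (C : MultiPOperator.{w} m) :
    A.actionDist C ≤ A.actionDist B + B.actionDist C := by
  rw [actionDist, actionDist, actionDist, ← ENNReal.tsum_add]
  refine ENNReal.tsum_le_tsum fun k => ?_
  rw [← mul_add]
  gcongr
  exact Metric.hausdorffEDist_triangle

theorem MultiPOperator.actionDist_comm {m : ℕ} (A : MultiPOperator.{u} m)
    (B : MultiPOperator.{v} m) : A.actionDist B = B.actionDist A := by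
  simp only [actionDist, Metric.hausdorffEDist_comm]

/-- Dominated convergence for the counting measure: each Hausdorff distance is at most 1, so the
geometric weights dominate the series. -/
theorem MultiPOperator.tendsto_actionDist {m : ℕ} {A : ℕ → MultiPOperator.{u} m}
    {L : MultiPOperator.{v} m}
    (h : ∀ k : ℕ, Tendsto (fun i => Metric.hausdorffEDist ((A i).profile k) (L.profile k))
      atTop (𝓝 0)) : Tendsto (fun i => (A i).actionDist L) atTop (𝓝 0) := by
  simp only [actionDist, ← lintegral_count]
  have e : ∫⁻ _k : ℕ, (0 : ℝ≥0∞) ∂Measure.count = 0 := by simp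
  rw [← e]
  refine tendsto_lintegral_of_dominated_convergence (fun k : ℕ => (2 : ℝ≥0∞)⁻¹ ^ (k + 1))
    (fun _ => Measurable.of_discrete) (fun i => Eventually.of_forall fun k => ?_) ?_
    (Eventually.of_forall fun k => ?_)
  · exact mul_le_of_le_one_right (by simp) (hausdorffEDist_profile_le_one _ _ _)
  · rw [lintegral_count, ENNReal.tsum_geometric_add_one]
    simp [ENNReal.mul_eq_top]
  · have := ENNReal.Tendsto.const_mul (a := (2 : ℝ≥0∞)⁻¹ ^ (k + 1)) (h (k + 1))
      (Or.inr (by simp))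
    simpa using this

theorem MultiPOperator.actionConvergesTo_of_tendsto_profile {m : ℕ}
    {A : ℕ → MultiPOperator.{u} m} {L : MultiPOperator.{v} m}
    (h : ∀ k : ℕ, Tendsto (fun i => Metric.hausdorffEDist ((A i).profile k) (L.profile k))
      atTop (𝓝 0)) : ActionConvergesTo A L := by
  refine ⟨fun ε hε => ?_, h⟩
  obtain ⟨N, hN⟩ := eventually_atTop.1
    ((tendsto_actionDist h).eventually (gt_mem_nhds (ENNReal.half_pos hε.ne')))
  refine ⟨N, fun i hi j hj => ?_⟩
  calc (A i).actionDist (A j) ≤ (A i).actionDist L + L.actionDist (A j) :=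
        actionDist_triangle _ _ _
    _ < ε / 2 + ε / 2 := by
        refine ENNReal.add_lt_add (hN i hi) ?_
        rw [actionDist_comm]
        exact hN j hj
    _ = ε := ENNReal.add_halves ε

/-- Operators given by normalized tensors are precompact for action convergence. -/
theorem exists_actionConvergesTo_subsequence {V : ℕ → Type} [∀ n, Fintype (V n)]
    [∀ n, Nonempty (V n)] (T : ∀ n, Tensor 3 (V n)) (hT : ∀ n, NormalizedTensor (T n)) :
    ∃ θ : ℕ → ℕ, StrictMono θ ∧ ∃ A : MultiPOperator.{0} 2,
      MultiPOperator.ActionConvergesTo (fun n => twoAction (T (θ n))) A := by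
  have hU : (hyperfilter ℕ : Filter ℕ) ≤ atTop := Nat.hyperfilter_le_atTop
  obtain ⟨μ, _, _, hμ⟩ := exists_isLimitMeasure (V := V) (hyperfilter ℕ)
  -- What holds for `U`-almost every `n` holds for infinitely many `n`. Treating the finitely many
  -- `k ≤ l` at once with tolerance $1/(l+1)$ lets a diagonal choice yield an ordinary subsequence.
  have hfreq : ∀ l : ℕ, ∃ᶠ n in atTop, ∀ k ∈ Set.Iic l,
      Metric.hausdorffEDist ((twoAction (T n)).profile k)
        ((limitOperator hT hμ hU).profile k) ≤ ((l : ℝ≥0∞) + 1)⁻¹ := by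
    intro l
    refine Frequently.filter_mono (Eventually.frequently ?_) hU
    refine (eventually_all_finite (Set.finite_Iic l)).2 fun k _ => ?_
    exact ENNReal.tendsto_nhds_zero.1 (tendsto_hausdorffEDist_limitOperator hT hμ hU k) _
      (by simp)
  obtain ⟨θ, hθ, h⟩ := extraction_forall_of_frequently hfreq
  refine ⟨θ, hθ, limitOperator hT hμ hU,
    MultiPOperator.actionConvergesTo_of_tendsto_profile fun k => ?_⟩
  have hlim : Tendsto (fun l : ℕ => ((l : ℝ≥0∞) + 1)⁻¹) atTop (𝓝 0) := by
    have := (tendsto_add_atTop_iff_nat 1).2 ENNReal.tendsto_inv_nat_nhds_zero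
    simpa using this
  refine tendsto_of_tendsto_of_tendsto_of_le_of_le' tendsto_const_nhds hlim
    (Eventually.of_forall fun _ => zero_le) ?_
  filter_upwards [eventually_ge_atTop k] with l hl
  exact h l k hl

/-! ### Concentration for random subsets -/

section Concentration

variable {α : Type u}

theorem measurableSet_superset (B : Finset α) : MeasurableSet {S : Set α | (B : Set α) ⊆ S} := by
  have e : {S : Set α | (B : Set α) ⊆ S} = ⋂ e ∈ B, {S : Set α | e ∈ S} := by
    ext S
    simp [Set.subset_def]
  rw [e]
  exact Finset.measurableSet_biInter B fun e _ => measurableSet_setOfPred.2 (measurable_set_mem e)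

variable {u : Set α} {p : unitInterval}

theorem setBernoulli_superset {B : Finset α} (hB : (B : Set α) ⊆ u) :
    setBernoulli u p {S : Set α | (B : Set α) ⊆ S} =
      (unitInterval.toNNReal p : ℝ≥0∞) ^ B.card := by
  rw [setBernoulli_apply']
  have e : (fun q : α → Prop => {i | q i}) ⁻¹' {S : Set α | (B : Set α) ⊆ S} =
      Set.pi (B : Set α) fun _ => {True} := by
    ext q
    simp [Set.subset_def]
  rw [e, Measure.infinitePi_pi _ fun _ _ => measurableSet_singleton _, ← Finset.prod_const]
  refine Finset.prod_congr rfl fun i hi => ?_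
  have hiu : i ∈ u := hB hi
  simp [hiu]

/-- Containing several blocks means containing their union, whose cardinality is the sum of theirs
by disjointness; hence the probabilities multiply. -/
theorem iIndepSet_superset {ι : Type v} {B : ι → Finset α}
    (hd : Pairwise fun i j => Disjoint (B i) (B j)) (hB : ∀ j, (B j : Set α) ⊆ u) :
    iIndepSet (fun j => {S : Set α | (B j : Set α) ⊆ S}) (setBernoulli u p) := by
  classical
  rw [iIndepSet_iff_meas_biInter fun j => measurableSet_superset (B j)]
  intro s
  have e : ⋂ i ∈ s, {S : Set α | (B i : Set α) ⊆ S} =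
      {S : Set α | ((s.biUnion B : Finset α) : Set α) ⊆ S} := by
    ext S
    simp
  rw [e, setBernoulli_superset (by simpa using fun i _ => hB i),
    Finset.card_biUnion fun i _ j _ hij => hd hij, ← Finset.prod_pow_eq_pow_sum]
  exact Finset.prod_congr rfl fun i _ => (setBernoulli_superset (hB i)).symm

/-- The indicator that a random set contains the block `B`. -/
def blockIndicator (B : Finset α) : Set α → ℝ :=
  {S : Set α | (B : Set α) ⊆ S}.indicator fun _ => 1

theorem blockIndicator_mem_Icc (B : Finset α) (S : Set α) :
    blockIndicator B S ∈ Set.Icc (0 : ℝ) 1 := by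
  unfold blockIndicator
  by_cases h : S ∈ {S : Set α | (B : Set α) ⊆ S}
  · simp [Set.indicator_of_mem h]
  · simp [Set.indicator_of_notMem h]

theorem measurable_blockIndicator (B : Finset α) : Measurable (blockIndicator B) :=
  measurable_const.indicator (measurableSet_superset B)

theorem integral_blockIndicator {B : Finset α} (hB : (B : Set α) ⊆ u) :
    ∫ S, blockIndicator B S ∂setBernoulli u p = (p : ℝ) ^ B.card := by
  have h : ∫ S, blockIndicator B S ∂setBernoulli u p =
      (setBernoulli u p).real {S : Set α | (B : Set α) ⊆ S} :=
    integral_indicator_one (measurableSet_superset B)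
  rw [h, measureReal_def, setBernoulli_superset hB]
  simp

/-- Hoeffding's inequality for the number of blocks contained in a random set. -/
theorem setBernoulli_real_abs_sum_le {ι : Type v} [Fintype ι] {B : ι → Finset α} {m : ℕ}
    (hd : Pairwise fun i j => Disjoint (B i) (B j)) (hB : ∀ j, (B j : Set α) ⊆ u)
    (hm : ∀ j, (B j).card = m) {N : ℝ} (hι : Fintype.card ι ≤ N) {ε : ℝ} (hε : 0 < ε) :
    (setBernoulli u p).real
      {S | ε * N ≤ |∑ j, (blockIndicator (B j) S - (p : ℝ) ^ m)|} ≤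
        2 * Real.exp (-(2 * ε ^ 2) * N) := by
  have hN : 0 ≤ N := (Nat.cast_nonneg _).trans hι
  rcases hN.eq_or_lt with rfl | hN
  · simp only [mul_zero, Real.exp_zero, mul_one]
    exact measureReal_le_one.trans (by norm_num)
  rcases isEmpty_or_nonempty ι with he | hne
  · have : {S : Set α | ε * N ≤ |∑ j, (blockIndicator (B j) S - (p : ℝ) ^ m)|} = ∅ := by
      ext S
      simp [mul_pos hε hN]
    rw [this, measureReal_empty]
    positivity
  have hcard : (0 : ℝ) < Fintype.card ι := by
    exact_mod_cast Fintype.card_pos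
  have hind : iIndepFun (fun j S => blockIndicator (B j) S - (p : ℝ) ^ m) (setBernoulli u p) :=
    (iIndepSet_superset hd hB).iIndepFun_indicator.comp (fun _ x => x - (p : ℝ) ^ m)
      fun _ => by fun_prop
  -- Hoeffding's lemma for a variable in $[0,1]$: the variance proxy is the square of half the
  -- length of the interval.
  have hsub : ∀ j, HasSubgaussianMGF (fun S => blockIndicator (B j) S - (p : ℝ) ^ m) (1 / 4)
      (setBernoulli u p) := by
    intro j
    have h := hasSubgaussianMGF_of_mem_Icc (μ := setBernoulli u p)
      (measurable_blockIndicator (B j)).aemeasurable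
      (Eventually.of_forall (blockIndicator_mem_Icc (B j)))
    rw [integral_blockIndicator (hB j), hm] at h
    convert h using 1
    norm_num
  have hind' : iIndepFun (fun j S => -(blockIndicator (B j) S - (p : ℝ) ^ m)) (setBernoulli u p) :=
    hind.comp (fun _ x => -x) fun _ => by fun_prop
  -- The exponent is $-2\varepsilon^2N^2/|\iota|$, and $|\iota|\le N$.
  have hexp : ∀ c : ℝ, c = Fintype.card ι * (1 / 4) →
      Real.exp (-(ε * N) ^ 2 / (2 * c)) ≤ Real.exp (-(2 * ε ^ 2) * N) := by
    rintro c rfl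
    rw [Real.exp_le_exp, div_le_iff₀ (by positivity)]
    have : ε ^ 2 * N * Fintype.card ι ≤ ε ^ 2 * N * N := by gcongr
    nlinarith
  have h1 := HasSubgaussianMGF.measure_sum_ge_le_of_iIndepFun hind (s := Finset.univ)
    (fun j _ => hsub j) (mul_pos hε hN).le
  have h2 := HasSubgaussianMGF.measure_sum_ge_le_of_iIndepFun hind' (s := Finset.univ)
    (fun j _ => (hsub j).neg) (mul_pos hε hN).le
  have h1' := h1.trans (hexp _ (by simp))
  have h2' := h2.trans (hexp _ (by simp))
  have hss : {S | ε * N ≤ |∑ j, (blockIndicator (B j) S - (p : ℝ) ^ m)|} ⊆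
      {S | ε * N ≤ ∑ j, (blockIndicator (B j) S - (p : ℝ) ^ m)} ∪
        {S | ε * N ≤ ∑ j, -(blockIndicator (B j) S - (p : ℝ) ^ m)} := by
    intro S hS
    rcases le_abs.1 (show ε * N ≤ _ from hS) with h | h
    · exact Or.inl h
    · right
      rw [← Finset.sum_neg_distrib] at h
      exact h
  calc _ ≤ _ := measureReal_mono hss
    _ ≤ _ := measureReal_union_le _ _
    _ ≤ _ := by linarith

/-- Block counts in a sequence of random sets are almost surely uniformly concentrated. -/
theorem ae_eventually_abs_sum_lt {Ξ : Type w} [MeasurableSpace Ξ] {P : Measure Ξ}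
    {α : ℕ → Type u} {u : ∀ n, Set (α n)}
    {S : ∀ n, Ξ → Set (α n)} (hS : ∀ n, HasLaw (S n) (setBernoulli (u n) p) P)
    {I : ℕ → Type v} [∀ n, Fintype (I n)] (hI : ∀ n, Fintype.card (I n) ≤ (n + 1) ^ 2)
    {ι : ∀ n, I n → Type v} [∀ n a, Fintype (ι n a)] (hι : ∀ n a, Fintype.card (ι n a) ≤ n + 1)
    {B : ∀ n a, ι n a → Finset (α n)} {m : ℕ}
    (hd : ∀ n a, Pairwise fun i j => Disjoint (B n a i) (B n a j))
    (hB : ∀ n a j, (B n a j : Set (α n)) ⊆ u n) (hm : ∀ n a j, (B n a j).card = m) :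
    ∀ᵐ ξ ∂P, ∀ ε : ℝ, 0 < ε → ∀ᶠ n in atTop, ∀ a : I n,
      |∑ j, (blockIndicator (B n a j) (S n ξ) - (p : ℝ) ^ m)| < ε * (n + 1) := by
  -- Countably many tolerances $1/(l+1)$ suffice. For each, the union bound gives failure
  -- probabilities of order $(n+1)^2e^{-c(n+1)}$, which are summable; this half of Borel–Cantelli
  -- needs no independence between different `n`.
  have key : ∀ l : ℕ, ∀ᵐ ξ ∂P, ∀ᶠ n in atTop, ξ ∉ S n ⁻¹' ⋃ a : I n,
      {Q | ((l : ℝ) + 1)⁻¹ * ((n : ℝ) + 1) ≤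
        |∑ j, (blockIndicator (B n a j) Q - (p : ℝ) ^ m)|} := by
    intro l
    have hl : (0 : ℝ) < ((l : ℝ) + 1)⁻¹ := by positivity
    have hr : (0 : ℝ) < 2 * (((l : ℝ) + 1)⁻¹) ^ 2 := by positivity
    refine ae_eventually_notMem (ne_top_of_le_ne_top (b := ∑' n : ℕ, ENNReal.ofReal
      (2 * (((n + 1 : ℕ) : ℝ) ^ 2 * Real.exp (-(2 * (((l : ℝ) + 1)⁻¹) ^ 2) *
        ((n + 1 : ℕ) : ℝ))))) ?_ (ENNReal.tsum_le_tsum fun n => ?_))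
    · refine Summable.tsum_ofReal_ne_top ?_
      exact ((summable_nat_add_iff 1).2 (Real.summable_pow_mul_exp_neg_nat_mul 2 hr)).mul_left 2
    -- Only an upper bound is needed, so the event need not be shown measurable.
    · have hle : P (S n ⁻¹' ⋃ a : I n, {Q | ((l : ℝ) + 1)⁻¹ * ((n : ℝ) + 1) ≤
          |∑ j, (blockIndicator (B n a j) Q - (p : ℝ) ^ m)|}) ≤ setBernoulli (u n) p
          (⋃ a : I n, {Q | ((l : ℝ) + 1)⁻¹ * ((n : ℝ) + 1) ≤
            |∑ j, (blockIndicator (B n a j) Q - (p : ℝ) ^ m)|}) := by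
        rw [← (hS n).map_eq]
        exact Measure.le_map_apply (hS n).aemeasurable _
      refine hle.trans ?_
      rw [← ofReal_measureReal]
      refine ENNReal.ofReal_le_ofReal ?_
      calc _ ≤ ∑ a : I n, (setBernoulli (u n) p).real
            {Q | ((l : ℝ) + 1)⁻¹ * ((n : ℝ) + 1) ≤
              |∑ j, (blockIndicator (B n a j) Q - (p : ℝ) ^ m)|} := measureReal_iUnion_fintype_le _
        _ ≤ ∑ _a : I n, 2 * Real.exp (-(2 * (((l : ℝ) + 1)⁻¹) ^ 2) * ((n : ℝ) + 1)) :=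
            Finset.sum_le_sum fun a _ => setBernoulli_real_abs_sum_le (hd n a) (hB n a) (hm n a)
              (by exact_mod_cast hι n a) hl
        _ ≤ _ := by
            rw [Finset.sum_const, Finset.card_univ, nsmul_eq_mul]
            have : (Fintype.card (I n) : ℝ) ≤ ((n : ℝ) + 1) ^ 2 := by exact_mod_cast hI n
            push_cast
            calc _ ≤ ((n : ℝ) + 1) ^ 2 *
                  (2 * Real.exp (-(2 * (((l : ℝ) + 1)⁻¹) ^ 2) * ((n : ℝ) + 1))) := by gcongr
              _ = _ := by ring
  filter_upwards [ae_all_iff.2 key] with ξ hξ ε hε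
  obtain ⟨l, hl⟩ := exists_nat_one_div_lt hε
  filter_upwards [hξ l] with n hn a
  simp only [Set.mem_preimage, Set.mem_iUnion, Set.mem_ofPred_eq, not_exists, not_le] at hn
  refine (hn a).trans_le ?_
  rw [one_div] at hl
  gcongr

end Concentration

/-! ### Codegrees -/

section Codegree

variable {V : Type u}

theorem adjacencyTensor_three (H : Hypergraph V) (j i k : V)
    [Decidable (({j, i, k} : Set V) ∈ H.edgeSet)] :
    adjacencyTensor 3 H ![j, i, k] = if ({j, i, k} : Set V) ∈ H.edgeSet then 1 else 0 := by
  have h : Set.range ![j, i, k] = ({j, i, k} : Set V) := by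
    ext x
    simp only [Set.mem_range, Set.mem_insert_iff, Set.mem_singleton_iff]
    constructor
    · rintro ⟨t, rfl⟩
      fin_cases t <;> simp
    · rintro (rfl | rfl | rfl)
      · exact ⟨0, rfl⟩
      · exact ⟨1, rfl⟩
      · exact ⟨2, rfl⟩
  simp only [adjacencyTensor, h]

variable [Fintype V]

open Classical in
/-- The number of the indices `j` for which `{j, i, k}` is an edge. -/
def codegree (H : Hypergraph V) (i k : V) : ℝ :=
  ∑ j : V, if ({j, i, k} : Set V) ∈ H.edgeSet then 1 else 0

theorem codegree_comm (H : Hypergraph V) (i k : V) : codegree H i k = codegree H k i := by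
  classical
  have h : ∀ j : V, ({j, i, k} : Set V) = {j, k, i} := fun j =>
    congrArg (insert j) (Set.pair_comm i k)
  unfold codegree
  exact Finset.sum_congr rfl fun j _ => if_congr (by rw [h]) rfl rfl

theorem twoActionFun_one (H : Hypergraph V) (p : SymSquare V) :
    twoActionFun (fun i => adjacencyTensor 3 H i / Fintype.card V) (fun _ => 1) (fun _ => 1) p =
      codegree H p.fst p.snd / Fintype.card V := by
  classical
  simp only [twoActionFun, adjacencyTensor_three, mul_one, ← Finset.sum_div]
  have h1 : ∀ i k : V, (∑ j : V, if ({j, i, k} : Set V) ∈ H.edgeSet then (1 : ℝ) else 0) =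
      codegree H i k := fun i k => by
    unfold codegree
    congr!
  rw [h1, h1, codegree_comm H p.snd]
  ring

theorem measurable_codegree (H : Hypergraph V) :
    Measurable fun p : SymSquare V => codegree H p.fst p.snd / Fintype.card V :=
  (SymSquare.measurable_iff _).2 fun i k => by rw [codegree_comm]

/-- Removes the degenerate indices, such as `j ∈ {i, k}` in a codegree, where the independent blocks
are not available; each costs at most 1. -/
theorem abs_sum_le_of_subtype [DecidableEq V] {f : V → ℝ} (hf : ∀ j, |f j| ≤ 1) (s : Finset V) {r : ℝ}
    (h : |∑ j : {j // j ∉ s}, f j| ≤ r) : |∑ j, f j| ≤ r + s.card := by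
  have e : ∑ j, f j = ∑ j ∈ s, f j + ∑ j : {j // j ∉ s}, f j := by
    rw [← Finset.sum_add_sum_compl s f, Finset.sum_subtype sᶜ (fun x => Finset.mem_compl) f]
  have h2 : |∑ j ∈ s, f j| ≤ s.card :=
    (Finset.abs_sum_le_sum_abs _ _).trans ((Finset.sum_le_sum fun j _ => hf j).trans (by simp))
  rw [e]
  exact (abs_add_le _ _).trans (by linarith)

variable [Nonempty V]

theorem coe_const_uniform (c : ℝ) : ⇑(Lp.const ∞ (uniform V) c) = fun _ => c :=
  funext ((ae_uniform_iff _).1 (Lp.coeFn_const (p := ∞) (μ := uniform V) c))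

theorem integral_lawOne (H : Hypergraph V)
    (ψ : BoundedContinuousFunction (ProfileSpace 2 1) ℝ) :
    ∫ x, ψ x ∂((normalizedTwoAction H).lawOne : Measure (ProfileSpace 2 1)) =
      ∫ p, ψ (point 1 1 (codegree H p.fst p.snd / Fintype.card V)) ∂uniform V := by
  refine (MultiPOperator.integral_law (normalizedTwoAction H) _ ψ).trans
    (integral_congr_ae (Eventually.of_forall fun p => congrArg ψ ?_))
  refine congrArg (WithLp.toLp 2) (funext ?_)
  rintro ⟨a, b⟩
  have h1 := congrFun (coe_const_uniform (V := V) 1)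
  have h2 : ∀ q : SymSquare V, twoActionFun (fun i => adjacencyTensor 3 H i / Fintype.card V)
      (Lp.const ∞ (uniform V) (1 : ℝ)) (Lp.const ∞ (uniform V) (1 : ℝ)) q =
        codegree H q.fst q.snd / Fintype.card V := fun q => by
    rw [coe_const_uniform, twoActionFun_one]
  refine Fin.lastCases ?_ (fun j => ?_) b
  · simp only [Fin.snoc_last]
    exact (congrFun (coe_op_twoAction (fun i => adjacencyTensor 3 H i / Fintype.card V)
      (fun _ => Lp.const ∞ (uniform V) 1)) p).trans (h2 p)
  · simp only [Fin.snoc_castSucc]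
    fin_cases j
    · exact h1 p
    · exact h1 p

end Codegree

/-! ### Convergence of averages -/

theorem integral_diagonal (V : Type u) [Fintype V] [Nonempty V] [DecidableEq V] :
    ∫ p : SymSquare V, (if p.fst = p.snd then (1 : ℝ) else 0) ∂uniform V =
      (Fintype.card V : ℝ)⁻¹ := by
  have hc : (Fintype.card V : ℝ) ≠ 0 := by simp
  rw [integral_uniform ((SymSquare.measurable_iff _).2 fun i j => by simp [eq_comm])]
  simp only [Finset.sum_ite_eq, Finset.mem_univ, if_true, Finset.sum_const, Finset.card_univ,
    nsmul_eq_mul, mul_one]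
  field_simp

/-- Off the diagonal `D n` is near `0` or near `c` according to `b n`, so `f (D n p)` is near `f 0 +
b n p * (f c - f 0)`. On the diagonal nothing is assumed, but it has mass $1/(n+1)$ and contributes
at most $2M/(n+1)$. -/
theorem tendsto_integral_of_close {D b : ∀ n : ℕ, SymSquare (Fin (n + 1)) → ℝ}
    (hD : ∀ n, Measurable (D n)) (hb : ∀ n, Measurable (b n)) (hb' : ∀ n p, b n p = 0 ∨ b n p = 1)
    {c q : ℝ} (hq : Tendsto (fun n => ∫ p, b n p ∂uniform (Fin (n + 1))) atTop (𝓝 q))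
    (hclose : ∀ ε : ℝ, 0 < ε → ∀ᶠ n in atTop, ∀ i k : Fin (n + 1), i ≠ k →
      |D n ⟨i, k⟩ - b n ⟨i, k⟩ * c| < ε)
    {f : ℝ → ℝ} (hf : Continuous f) {M : ℝ} (hM : ∀ t, |f t| ≤ M) :
    Tendsto (fun n => ∫ p, f (D n p) ∂uniform (Fin (n + 1))) atTop
      (𝓝 ((1 - q) * f 0 + q * f c)) := by
  have h1 : Tendsto (fun n => ∫ p, (f 0 + b n p * (f c - f 0)) ∂uniform (Fin (n + 1))) atTop
      (𝓝 ((1 - q) * f 0 + q * f c)) := by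
    have e : ∀ n, ∫ p, (f 0 + b n p * (f c - f 0)) ∂uniform (Fin (n + 1)) =
        f 0 + (∫ p, b n p ∂uniform (Fin (n + 1))) * (f c - f 0) := fun n => by
      rw [integral_add (integrable_const _) ((integrable_uniform (hb n)).mul_const _),
        integral_mul_const]
      simp
    simp only [e]
    have := (hq.mul_const (f c - f 0)).const_add (f 0)
    convert this using 2
    ring
  have h2 : Tendsto (fun n => (∫ p, f (D n p) ∂uniform (Fin (n + 1))) -
      ∫ p, (f 0 + b n p * (f c - f 0)) ∂uniform (Fin (n + 1))) atTop (𝓝 0) := by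
    rw [Metric.tendsto_atTop]
    intro ε hε
    have hM0 : 0 ≤ M := (abs_nonneg _).trans (hM 0)
    obtain ⟨δ, hδ, hδf⟩ := Metric.continuous_iff.1 hf 0 (ε / 2) (half_pos hε)
    obtain ⟨δ', hδ', hδf'⟩ := Metric.continuous_iff.1 hf c (ε / 2) (half_pos hε)
    have hdiag : Tendsto (fun n : ℕ => 2 * M * ((n : ℝ) + 1)⁻¹) atTop (𝓝 0) := by
      have := (tendsto_one_div_add_atTop_nhds_zero_nat (𝕜 := ℝ)).const_mul (2 * M)
      simpa using this
    obtain ⟨n0, hn0⟩ := eventually_atTop.1 ((hclose (min δ δ') (lt_min hδ hδ')).and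
      (hdiag.eventually (gt_mem_nhds (half_pos hε))))
    refine ⟨n0, fun n hn => ?_⟩
    obtain ⟨hc1, hc2⟩ := hn0 n hn
    have hfm : Measurable fun p => f (D n p) := hf.measurable.comp (hD n)
    have hbm : Measurable fun p => f 0 + b n p * (f c - f 0) :=
      measurable_const.add ((hb n).mul_const _)
    have hdm : Measurable fun p : SymSquare (Fin (n + 1)) =>
        ε / 2 + 2 * M * (if p.fst = p.snd then (1 : ℝ) else 0) :=
      (SymSquare.measurable_iff _).2 fun i j => by simp [eq_comm]
    have hdm' : Measurable fun p : SymSquare (Fin (n + 1)) =>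
        (if p.fst = p.snd then (1 : ℝ) else 0) :=
      (SymSquare.measurable_iff _).2 fun i j => by simp [eq_comm]
    have hpt : ∀ p : SymSquare (Fin (n + 1)), |f (D n p) - (f 0 + b n p * (f c - f 0))| ≤
        ε / 2 + 2 * M * (if p.fst = p.snd then (1 : ℝ) else 0) := by
      rintro ⟨i, k⟩
      by_cases hik : i = k
      · rw [if_pos hik]
        have hA := abs_le.1 (hM (D n ⟨i, k⟩))
        have hB := abs_le.1 (hM 0)
        have hC := abs_le.1 (hM c)
        rcases hb' n ⟨i, k⟩ with h | h <;> rw [h, abs_le] <;> constructor <;> linarith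
      · rw [if_neg hik]
        have hcl := hc1 i k hik
        rcases hb' n ⟨i, k⟩ with h | h
        · rw [h] at hcl ⊢
          have := hδf (D n ⟨i, k⟩) (by
            rw [Real.dist_eq]
            simpa using hcl.trans_le (min_le_left _ _))
          rw [Real.dist_eq] at this
          simpa using this.le
        · rw [h] at hcl ⊢
          have := hδf' (D n ⟨i, k⟩) (by
            rw [Real.dist_eq]
            simpa using hcl.trans_le (min_le_right _ _))
          rw [Real.dist_eq] at this
          simpa using this.le
    rw [Real.dist_eq, sub_zero, ← integral_sub (integrable_uniform hfm) (integrable_uniform hbm)]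
    calc _ ≤ ∫ p, |f (D n p) - (f 0 + b n p * (f c - f 0))| ∂uniform (Fin (n + 1)) :=
          abs_integral_le_integral_abs
      _ ≤ ∫ p : SymSquare (Fin (n + 1)), (ε / 2 + 2 * M * (if p.fst = p.snd then (1 : ℝ) else 0))
            ∂uniform (Fin (n + 1)) :=
          integral_mono (integrable_uniform (hfm.sub hbm)).abs (integrable_uniform hdm) hpt
      _ = ε / 2 + 2 * M * ((n : ℝ) + 1)⁻¹ := by
          rw [integral_add (integrable_const _) ((integrable_uniform hdm').const_mul _),
            integral_const_mul, integral_diagonal]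
          simp
      _ < ε := by linarith
  have h3 := h2.add h1
  simpa using h3

theorem continuous_point : Continuous fun t : ℝ => point 1 1 t := by
  refine (PiLp.continuous_toLp 2 _).comp (continuous_pi ?_)
  rintro ⟨a, b⟩
  fin_cases b
  · exact continuous_const
  · exact continuous_const
  · exact continuous_id

/-- If all codegrees are close to `c` on a set of pairs of density `q`, and to `0` elsewhere, the
laws at the constant input converge to a mixture of two Dirac measures. -/
theorem tendsto_integral_lawOne {H : ∀ n : ℕ, Hypergraph (Fin (n + 1))}
    {b : ∀ n : ℕ, SymSquare (Fin (n + 1)) → ℝ}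
    (hb : ∀ n, Measurable (b n)) (hb' : ∀ n p, b n p = 0 ∨ b n p = 1) {c q : ℝ}
    (hq : Tendsto (fun n => ∫ p, b n p ∂uniform (Fin (n + 1))) atTop (𝓝 q))
    (hclose : ∀ ε : ℝ, 0 < ε → ∀ᶠ n in atTop, ∀ i k : Fin (n + 1), i ≠ k →
      |codegree (H n) i k - ((n : ℝ) + 1) * (b n ⟨i, k⟩ * c)| < ε * ((n : ℝ) + 1))
    (ψ : BoundedContinuousFunction (ProfileSpace 2 1) ℝ) :
    Tendsto (fun n => ∫ x, ψ x
      ∂((normalizedTwoAction (H n)).lawOne : Measure (ProfileSpace 2 1))) atTop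
      (𝓝 ((1 - q) * ψ (point 1 1 0) + q * ψ (point 1 1 c))) := by
  simp only [integral_lawOne]
  refine tendsto_integral_of_close (f := fun t => ψ (point 1 1 t))
    (fun n => measurable_codegree (H n)) hb hb' hq (fun ε hε => ?_)
    (ψ.continuous.comp continuous_point) (M := ‖ψ‖) (fun t => ψ.norm_coe_le_norm _)
  filter_upwards [hclose ε hε] with n hn i k hik
  have hpos : (0 : ℝ) < (n : ℝ) + 1 := by positivity
  have h := hn i k hik
  simp only [Fintype.card_fin, Nat.cast_add, Nat.cast_one]
  rw [show codegree (H n) i k / ((n : ℝ) + 1) - b n ⟨i, k⟩ * c =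
    (codegree (H n) i k - ((n : ℝ) + 1) * (b n ⟨i, k⟩ * c)) / ((n : ℝ) + 1) by field_simp,
    abs_div, abs_of_pos hpos, div_lt_iff₀ hpos]
  exact h

/-! ### Codegrees of the random hypergraphs -/

theorem blockIndicator_apply {α : Type u} (B : Finset α) (S : Set α)
    [Decidable ((B : Set α) ⊆ S)] :
    blockIndicator B S = if (B : Set α) ⊆ S then 1 else 0 := by
  unfold blockIndicator
  rw [Set.indicator_apply]
  congr

theorem eventually_half_mul_add_lt (c : ℝ) {ε : ℝ} (hε : 0 < ε) :
    ∀ᶠ n : ℕ in atTop, ε / 2 * ((n : ℝ) + 1) + c < ε * ((n : ℝ) + 1) := by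
  have h : Tendsto (fun n : ℕ => ε / 2 * ((n : ℝ) + 1)) atTop atTop :=
    (tendsto_atTop_add_const_right _ _ tendsto_natCast_atTop_atTop).const_mul_atTop (half_pos hε)
  filter_upwards [h.eventually_gt_atTop c] with n hn
  linarith

/-- For fixed $i\ne k$ the blocks are the single triples $\{j,i,k\}$ with $j\notin\{i,k\}$, distinct
for distinct `j`. The form `1 * p` anticipates `tendsto_integral_lawOne` with `b = 1`. -/
theorem ae_codegree_erdosRenyi {Ξ : Type u} [MeasurableSpace Ξ] {P : Measure Ξ}
    {G : ∀ n : ℕ, Ξ → Hypergraph (Fin (n + 1))} {p : unitInterval}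
    (hG : ∀ n, IsErdosRenyiHypergraph (G n) p 3 P) :
    ∀ᵐ ξ ∂P, ∀ ε : ℝ, 0 < ε → ∀ᶠ n in atTop, ∀ i k : Fin (n + 1), i ≠ k →
      |codegree (G n ξ) i k - ((n : ℝ) + 1) * (1 * p)| < ε * ((n : ℝ) + 1) := by
  classical
  have key := ae_eventually_abs_sum_lt (fun n => (hG n).hasLaw)
    (I := fun n => {x : Fin (n + 1) × Fin (n + 1) // x.1 ≠ x.2})
    (fun n => (Fintype.card_subtype_le _).trans (by simp [sq]))
    (ι := fun n a => {j : Fin (n + 1) // j ∉ ({a.1.1, a.1.2} : Finset (Fin (n + 1)))})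
    (fun n a => (Fintype.card_subtype_le _).trans (by simp))
    (B := fun n a j => {({(j : Fin (n + 1)), a.1.1, a.1.2} : Set (Fin (n + 1)))}) (m := 1)
    (by
      rintro n ⟨⟨i, k⟩, hik⟩ ⟨j, hj⟩ ⟨j', hj'⟩ hne
      simp only [Finset.mem_insert, Finset.mem_singleton, not_or] at hj hj'
      rw [Finset.disjoint_singleton]
      intro h
      have h1 : j ∈ ({j', i, k} : Set (Fin (n + 1))) := h ▸ Set.mem_insert j _
      simp only [Set.mem_insert_iff, Set.mem_singleton_iff, hj.1, hj.2, or_false] at h1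
      exact hne (Subtype.ext h1))
    (by
      rintro n ⟨⟨i, k⟩, hik⟩ ⟨j, hj⟩
      simp only [Finset.mem_insert, Finset.mem_singleton, not_or] at hj
      simp only [Finset.coe_singleton, Set.singleton_subset_iff, Set.mem_ofPred_eq]
      exact Set.ncard_eq_three.2 ⟨j, i, k, hj.1, hj.2, hik, rfl⟩)
    (by simp)
  filter_upwards [key] with ξ hξ ε hε
  -- Half of `ε` absorbs the fluctuation, the other half the two omitted indices `i` and `k`.
  filter_upwards [hξ (ε / 2) (half_pos hε), eventually_half_mul_add_lt 2 hε] with n hn hn2 i k hik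
  have hp0 := p.2.1
  have hp1 := p.2.2
  have h := hn ⟨(i, k), hik⟩
  have h2 := abs_sum_le_of_subtype
    (f := fun j => (if ({j, i, k} : Set (Fin (n + 1))) ∈ (G n ξ).edgeSet then (1 : ℝ) else 0) - p)
    (fun j => by rw [abs_le]; split_ifs <;> constructor <;> linarith) {i, k}
    (r := ε / 2 * ((n : ℝ) + 1)) (by
      refine le_of_lt (lt_of_eq_of_lt ?_ h)
      refine congrArg abs (Finset.sum_congr rfl fun j _ => ?_)
      rw [blockIndicator_apply]
      simp)
  have h3 : ((({i, k} : Finset (Fin (n + 1))).card : ℕ) : ℝ) ≤ 2 := by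
    exact_mod_cast Finset.card_le_two
  refine lt_of_le_of_lt ?_ hn2
  refine le_trans (le_of_eq ?_) (h2.trans (by linarith))
  congr 1
  rw [Finset.sum_sub_distrib, codegree]
  simp

/-- The random graph is defined by pulling back the random set of pairs along `edgeSet`. Pushing
forward again restricts that measure to the range of `edgeSet`, which has full measure because the
random set almost surely avoids the diagonal. -/
theorem hasLaw_edgeSet {V : Type u} [Countable V] {Ξ : Type v} [MeasurableSpace Ξ] {P : Measure Ξ}
    {G : Ξ → SimpleGraph V} {p : unitInterval} (hG : HasLaw G (SimpleGraph.binomialRandom V p) P) :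
    HasLaw (fun ξ => (G ξ).edgeSet) (setBernoulli (Sym2.diagSet (α := V))ᶜ p) P := by
  refine ⟨SimpleGraph.measurable_edgeSet.comp_aemeasurable hG.aemeasurable, ?_⟩
  have h := AEMeasurable.map_map_of_aemeasurable
    (SimpleGraph.measurable_edgeSet (V := V)).aemeasurable hG.aemeasurable
  refine h.symm.trans ?_
  rw [hG.map_eq, SimpleGraph.binomialRandom, SimpleGraph.measurableEmbedding_edgeSet.map_comap]
  refine Measure.restrict_eq_self_of_ae_mem ?_
  filter_upwards [setBernoulli_ae_subset] with s hs
  exact ⟨.fromEdgeSet s, by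
    simpa [← Set.disjoint_compl_right_iff_subset, ← Set.compl_ofPred] using hs⟩

open Classical in
/-- The adjacency matrix of a graph, as a function on the symmetric square. -/
def adjacencyFun {V : Type u} (G : SimpleGraph V) (p : SymSquare V) : ℝ :=
  if G.Adj p.fst p.snd then 1 else 0

theorem measurable_adjacencyFun {V : Type u} (G : SimpleGraph V) : Measurable (adjacencyFun G) :=
  (SymSquare.measurable_iff _).2 fun i j => by
    classical
    unfold adjacencyFun
    exact if_congr (G.adj_comm i j) rfl rfl

theorem adjacencyFun_eq {V : Type u} (G : SimpleGraph V) (p : SymSquare V) :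
    adjacencyFun G p = 0 ∨ adjacencyFun G p = 1 := by
  unfold adjacencyFun
  split_ifs <;> simp

theorem mem_edgeSet_triangleHypergraph {V : Type u} (G : SimpleGraph V) (j i k : V) :
    ({j, i, k} : Set V) ∈ (triangleHypergraph G).edgeSet ↔
      G.Adj j i ∧ G.Adj j k ∧ G.Adj i k := by
  classical
  rw [← SimpleGraph.is3Clique_triple_iff]
  constructor
  · rintro ⟨s, hs, he⟩
    have : s = {j, i, k} := by
      apply Finset.coe_injective
      rw [← he]
      simp
    rwa [this] at hs
  · intro h
    exact ⟨_, h, by simp⟩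

/-- The blocks are the pairs of edges $\{ji,jk\}$, disjoint for distinct `j`, so the number of
common neighbours concentrates. The estimate is uniform over all pairs, so it may be multiplied by
the random indicator of the edge $ik$ afterwards. -/
theorem ae_codegree_triangle {Ξ : Type u} [MeasurableSpace Ξ] {P : Measure Ξ}
    {G : ∀ n : ℕ, Ξ → SimpleGraph (Fin (n + 1))} {p : unitInterval}
    (hG : ∀ n, HasLaw (G n) (SimpleGraph.binomialRandom (Fin (n + 1)) p) P) :
    ∀ᵐ ξ ∂P, ∀ ε : ℝ, 0 < ε → ∀ᶠ n in atTop, ∀ i k : Fin (n + 1), i ≠ k →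
      |codegree (triangleHypergraph (G n ξ)) i k -
        ((n : ℝ) + 1) * (adjacencyFun (G n ξ) ⟨i, k⟩ * (p : ℝ) ^ 2)| < ε * ((n : ℝ) + 1) := by
  classical
  have key := ae_eventually_abs_sum_lt (fun n => hasLaw_edgeSet (hG n))
    (I := fun n => {x : Fin (n + 1) × Fin (n + 1) // x.1 ≠ x.2})
    (fun n => (Fintype.card_subtype_le _).trans (by simp [sq]))
    (ι := fun n a => {j : Fin (n + 1) // j ∉ ({a.1.1, a.1.2} : Finset (Fin (n + 1)))})
    (fun n a => (Fintype.card_subtype_le _).trans (by simp))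
    (B := fun n a j => {s((j : Fin (n + 1)), a.1.1), s((j : Fin (n + 1)), a.1.2)}) (m := 2)
    (by
      rintro n ⟨⟨i, k⟩, hik⟩ ⟨j, hj⟩ ⟨j', hj'⟩ hne
      simp only [Finset.mem_insert, Finset.mem_singleton, not_or] at hj hj'
      rw [Finset.disjoint_left]
      intro e he he'
      refine hne (Subtype.ext ?_)
      have h1 : j ∈ e := by
        simp only [Finset.mem_insert, Finset.mem_singleton] at he
        rcases he with rfl | rfl <;> simp
      simp only [Finset.mem_insert, Finset.mem_singleton] at he'
      rcases he' with rfl | rfl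
      · simpa [hj.1, hj.2] using h1
      · simpa [hj.1, hj.2] using h1)
    (by
      rintro n ⟨⟨i, k⟩, hik⟩ ⟨j, hj⟩
      simp only [Finset.mem_insert, Finset.mem_singleton, not_or] at hj
      simp [Set.insert_subset_iff, hj.1, hj.2])
    (by
      rintro n ⟨⟨i, k⟩, hik⟩ ⟨j, hj⟩
      simp only [Finset.mem_insert, Finset.mem_singleton, not_or] at hj
      refine Finset.card_pair fun h => hik ?_
      simpa [hj.1, hj.2] using h)
  filter_upwards [key] with ξ hξ ε hε
  filter_upwards [hξ (ε / 2) (half_pos hε), eventually_half_mul_add_lt 2 hε] with n hn hn2 i k hik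
  have hp0 : 0 ≤ (p : ℝ) ^ 2 := by positivity
  have hp1 : (p : ℝ) ^ 2 ≤ 1 := pow_le_one₀ p.2.1 p.2.2
  have h := hn ⟨(i, k), hik⟩
  set b := adjacencyFun (G n ξ) ⟨i, k⟩ with hb
  have hb01 : b = 0 ∨ b = 1 := adjacencyFun_eq _ _
  have h2 := abs_sum_le_of_subtype (f := fun j =>
      (if ({j, i, k} : Set (Fin (n + 1))) ∈ (triangleHypergraph (G n ξ)).edgeSet
        then (1 : ℝ) else 0) - b * (p : ℝ) ^ 2)
    (fun j => by
      rw [abs_le]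
      rcases hb01 with h | h <;> rw [h] <;> split_ifs <;> constructor <;> linarith) {i, k}
    (r := ε / 2 * ((n : ℝ) + 1)) (by
      have e : ∑ j : {j : Fin (n + 1) // j ∉ ({i, k} : Finset (Fin (n + 1)))},
          ((if ({(j : Fin (n + 1)), i, k} : Set (Fin (n + 1))) ∈
            (triangleHypergraph (G n ξ)).edgeSet then (1 : ℝ) else 0) - b * (p : ℝ) ^ 2) =
          b * ∑ j : {j : Fin (n + 1) // j ∉ ({i, k} : Finset (Fin (n + 1)))},
            (blockIndicator {s((j : Fin (n + 1)), i), s((j : Fin (n + 1)), k)} (G n ξ).edgeSet -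
              (p : ℝ) ^ 2) := by
        rw [Finset.mul_sum]
        refine Finset.sum_congr rfl fun j _ => ?_
        rw [blockIndicator_apply]
        simp only [mem_edgeSet_triangleHypergraph, Finset.coe_insert, Finset.coe_singleton,
          Set.insert_subset_iff, Set.singleton_subset_iff, SimpleGraph.mem_edgeSet]
        rw [hb, adjacencyFun]
        by_cases h1 : (G n ξ).Adj i k
        · simp [h1]
        · simp [h1]
      rw [e, abs_mul]
      have hb1 : |b| ≤ 1 := by rcases hb01 with h | h <;> simp [h]
      exact (mul_le_of_le_one_left (abs_nonneg _) hb1).trans h.le)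
  have h3 : ((({i, k} : Finset (Fin (n + 1))).card : ℕ) : ℝ) ≤ 2 := by
    exact_mod_cast Finset.card_le_two
  refine lt_of_le_of_lt ?_ hn2
  refine le_trans (le_of_eq ?_) (h2.trans (by linarith))
  congr 1
  rw [Finset.sum_sub_distrib, codegree]
  simp

/-- All degrees concentrate: within row `i` the blocks are the single edges at `i`. Different rows
share edges, but they are only combined by a union bound. -/
theorem ae_tendsto_integral_adjacencyFun {Ξ : Type u} [MeasurableSpace Ξ] {P : Measure Ξ}
    {G : ∀ n : ℕ, Ξ → SimpleGraph (Fin (n + 1))} {p : unitInterval}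
    (hG : ∀ n, HasLaw (G n) (SimpleGraph.binomialRandom (Fin (n + 1)) p) P) :
    ∀ᵐ ξ ∂P, Tendsto (fun n => ∫ q, adjacencyFun (G n ξ) q ∂uniform (Fin (n + 1))) atTop
      (𝓝 (p : ℝ)) := by
  classical
  have key := ae_eventually_abs_sum_lt (fun n => hasLaw_edgeSet (hG n))
    (I := fun n => Fin (n + 1)) (fun n => by simp [sq])
    (ι := fun n i => {j : Fin (n + 1) // j ∉ ({i} : Finset (Fin (n + 1)))})
    (fun n a => (Fintype.card_subtype_le _).trans (by simp))
    (B := fun n i j => {s(i, (j : Fin (n + 1)))}) (m := 1)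
    (by
      rintro n i ⟨j, hj⟩ ⟨j', hj'⟩ hne
      rw [Finset.disjoint_singleton]
      intro h
      simp only [Finset.mem_singleton] at hj
      exact hne (Subtype.ext (by simpa [hj] using h)))
    (by
      rintro n i ⟨j, hj⟩
      simp only [Finset.mem_singleton] at hj
      simp [Ne.symm hj])
    (by simp)
  filter_upwards [key] with ξ hξ
  rw [Metric.tendsto_atTop]
  intro ε hε
  refine eventually_atTop.1 ?_
  filter_upwards [hξ (ε / 2) (half_pos hε), eventually_half_mul_add_lt 1 hε] with n hn hn2
  have hp0 := p.2.1
  have hp1 := p.2.2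
  have hrow : ∀ i : Fin (n + 1), |∑ j : Fin (n + 1), (adjacencyFun (G n ξ) ⟨i, j⟩ - p)| ≤
      ε / 2 * ((n : ℝ) + 1) + 1 := by
    intro i
    have h2 := abs_sum_le_of_subtype (f := fun j => adjacencyFun (G n ξ) ⟨i, j⟩ - p)
      (fun j => by
        rw [abs_le]
        rcases adjacencyFun_eq (G n ξ) ⟨i, j⟩ with h | h <;> rw [h] <;> constructor <;> linarith)
      {i} (r := ε / 2 * ((n : ℝ) + 1)) (by
        refine le_of_lt (lt_of_eq_of_lt ?_ (hn i))
        refine congrArg abs (Finset.sum_congr rfl fun j _ => ?_)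
        rw [blockIndicator_apply, adjacencyFun]
        simp)
    simpa using h2
  have hpos : (0 : ℝ) < (n : ℝ) + 1 := by positivity
  rw [integral_uniform (measurable_adjacencyFun _), Real.dist_eq]
  have e : ((Fintype.card (Fin (n + 1)) : ℝ) ^ 2)⁻¹ *
      ∑ i : Fin (n + 1), ∑ j : Fin (n + 1), adjacencyFun (G n ξ) ⟨i, j⟩ - p =
      (((n : ℝ) + 1) ^ 2)⁻¹ *
        ∑ i : Fin (n + 1), ∑ j : Fin (n + 1), (adjacencyFun (G n ξ) ⟨i, j⟩ - p) := by
    simp only [Finset.sum_sub_distrib, Finset.sum_const, Finset.card_univ, Fintype.card_fin,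
      nsmul_eq_mul, Nat.cast_add, Nat.cast_one]
    field_simp
  rw [e, abs_mul, abs_of_pos (by positivity), inv_mul_lt_iff₀ (by positivity)]
  calc _ ≤ ∑ i : Fin (n + 1), (ε / 2 * ((n : ℝ) + 1) + 1) :=
        (Finset.abs_sum_le_sum_abs _ _).trans (Finset.sum_le_sum fun i _ => hrow i)
    _ = ((n : ℝ) + 1) * (ε / 2 * ((n : ℝ) + 1) + 1) := by
        simp only [Finset.sum_const, Finset.card_univ, Fintype.card_fin, nsmul_eq_mul, Nat.cast_add,
          Nat.cast_one]
    _ < ((n : ℝ) + 1) * (ε * ((n : ℝ) + 1)) := by gcongr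
    _ = _ := by ring

/-! ### Laws at the constant input -/

theorem integral_diracProb (a : ProfileSpace 2 1) (ψ : ProfileSpace 2 1 → ℝ) :
    ∫ x, ψ x ∂(diracProb a : Measure (ProfileSpace 2 1)) = ψ a :=
  integral_dirac ψ a

theorem integral_diracMix (a b : ProfileSpace 2 1)
    (ψ : BoundedContinuousFunction (ProfileSpace 2 1) ℝ) :
    ∫ x, ψ x ∂(diracMix a b : Measure (ProfileSpace 2 1)) = 1 / 2 * ψ a + 1 / 2 * ψ b := by
  change ∫ x, ψ x ∂((2 : ℝ≥0∞)⁻¹ • Measure.dirac a + (2 : ℝ≥0∞)⁻¹ • Measure.dirac b) = _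
  rw [integral_add_measure ((ψ.integrable _).smul_measure (by simp))
    ((ψ.integrable _).smul_measure (by simp)), integral_smul_measure, integral_smul_measure,
    integral_dirac, integral_dirac]
  simp

theorem ae_tendsto_lawOne_erdosRenyi {Ξ : Type u} [MeasurableSpace Ξ] {P : Measure Ξ}
    {G : ∀ n : ℕ, Ξ → Hypergraph (Fin (n + 1))}
    (hG : ∀ n, IsErdosRenyiHypergraph (G n) oneEighth 3 P) :
    ∀ᵐ ξ ∂P, Tendsto (fun n => (normalizedTwoAction (G n ξ)).lawOne) atTop
      (𝓝 (diracProb (point 1 1 (1 / 8)))) := by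
  filter_upwards [ae_codegree_erdosRenyi hG] with ξ hξ
  refine ProbabilityMeasure.tendsto_iff_forall_integral_tendsto.2 fun ψ => ?_
  have h := tendsto_integral_lawOne (b := fun _ _ => 1) (q := 1) (fun _ => measurable_const)
    (fun _ _ => Or.inr rfl) (by simp) hξ ψ
  rw [integral_diracProb]
  simpa [oneEighth] using h

theorem ae_tendsto_lawOne_triangle {Ξ : Type u} [MeasurableSpace Ξ] {P : Measure Ξ}
    {T : ∀ n : ℕ, Ξ → Hypergraph (Fin (n + 1))}
    (hT : ∀ n, IsTriangleHypergraph (T n) oneHalf P) :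
    ∀ᵐ ξ ∂P, Tendsto (fun n => (normalizedTwoAction (T n ξ)).lawOne) atTop
      (𝓝 (diracMix (point 1 1 0) (point 1 1 (1 / 4)))) := by
  choose G hG hTG using hT
  filter_upwards [ae_codegree_triangle hG, ae_tendsto_integral_adjacencyFun hG] with ξ hξ hq
  refine ProbabilityMeasure.tendsto_iff_forall_integral_tendsto.2 fun ψ => ?_
  have h := tendsto_integral_lawOne (fun n => measurable_adjacencyFun (G n ξ))
    (fun n => adjacencyFun_eq (G n ξ)) hq hξ ψ
  rw [integral_diracMix]
  simp only [hTG]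
  convert h using 3
  · norm_num [oneHalf]
  · norm_num [oneHalf]

/-! ### Separation of the limits -/

/-- The truncated distance of a coordinate from a constant. -/
def coordDist (q : Fin 1 × Fin 3) (a : ℝ) : BoundedContinuousFunction (ProfileSpace 2 1) ℝ :=
  BoundedContinuousFunction.ofNormedAddCommGroup (fun x => min |x q - a| 2) (by fun_prop) 2
    fun x => by
      rw [Real.norm_eq_abs, abs_of_nonneg (le_min (abs_nonneg _) (by norm_num))]
      exact min_le_right _ _

theorem coordDist_apply (q : Fin 1 × Fin 3) (a : ℝ) (x : ProfileSpace 2 1) :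
    coordDist q a x = min |x q - a| 2 := rfl

/-- The truncation in `coordDist` is there only to have a bounded test function; it is inactive on
the values that occur. -/
theorem min_abs_sub_two {x a : ℝ} (hx : |x| ≤ 1) (ha : |a| ≤ 1) : min |x - a| 2 = |x - a| :=
  min_eq_left ((abs_sub _ _).trans (by linarith))

section Separation

variable {V : Type} [Fintype V] [Nonempty V]

theorem integral_law_coordDist_input (H : Hypergraph V) {f : Fin 1 → Fin 2 → Lp ℝ ∞ (uniform V)}
    (hf : ∀ a j p, |f a j p| ≤ 1) (j : Fin 2) :
    ∫ x, coordDist (0, j.castSucc) 1 x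
      ∂((normalizedTwoAction H).law f : Measure (ProfileSpace 2 1)) =
        ∫ p, |f 0 j p - 1| ∂uniform V := by
  refine (MultiPOperator.integral_law (normalizedTwoAction H) f _).trans
    (integral_congr_ae (Eventually.of_forall fun p => ?_))
  refine Eq.trans ?_ (min_abs_sub_two (hf 0 j p) (by simp))
  simp only [coordDist_apply, MultiPOperator.randomVector, Fin.snoc_castSucc]
  rfl

theorem integral_law_coordDist_output (H : Hypergraph V) {f : Fin 1 → Fin 2 → Lp ℝ ∞ (uniform V)}
    (hf : ∀ a j p, |f a j p| ≤ 1) {c : ℝ} (hc : |c| ≤ 1) :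
    ∫ x, coordDist (0, Fin.last 2) c x
      ∂((normalizedTwoAction H).law f : Measure (ProfileSpace 2 1)) =
        ∫ p, |twoActionFun (fun i => adjacencyTensor 3 H i / Fintype.card V) (f 0 0) (f 0 1) p - c|
          ∂uniform V := by
  refine (MultiPOperator.integral_law (normalizedTwoAction H) f _).trans
    (integral_congr_ae (Eventually.of_forall fun p => ?_))
  have hb := (normalizedTensor_adjacencyTensor H).abs_twoActionFun_le_mul (hf 0 0) (hf 0 1) p
  rw [one_mul] at hb
  refine Eq.trans ?_ (min_abs_sub_two hb hc)
  have h := congrFun (coe_op_twoAction (fun i => adjacencyTensor 3 H i / Fintype.card V) (f 0)) p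
  rw [← h]
  simp only [coordDist_apply, MultiPOperator.randomVector, Fin.snoc_last]
  rfl

/-- The `2`-action is close to its value at the constant input if the inputs are close to `1`. -/
theorem NormalizedTensor.integral_abs_twoActionFun_sub_le {T : Tensor 3 V}
    (hT : NormalizedTensor T) {f g : SymSquare V → ℝ} (hf : Measurable f) (hg : Measurable g)
    (hg1 : ∀ p, |g p| ≤ 1) (c : ℝ) :
    ∫ p, |twoActionFun T f g p - c| ∂uniform V ≤
      (∫ p, |f p - 1| ∂uniform V) + (∫ p, |g p - 1| ∂uniform V) +
        ∫ p, |twoActionFun T (fun _ => 1) (fun _ => 1) p - c| ∂uniform V := by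
  have h1 := hT.integral_abs_twoActionFun_le_left (f := fun p => f p - 1) (hf.sub_const 1) hg1
  have h2 := hT.integral_abs_twoActionFun_le_right (f := fun _ => 1) (g := fun p => g p - 1)
    (hg.sub_const 1) (a := 1) (by simp)
  rw [one_mul] at h1 h2
  have hm : ∀ f g : SymSquare V → ℝ, Integrable (twoActionFun T f g) (uniform V) := fun f g =>
    integrable_uniform (measurable_twoActionFun T f g)
  have hA := (hm (fun p => f p - 1) g).abs
  have hB := (hm (fun _ => 1) (fun p => g p - 1)).abs
  have hC : Integrable (fun p => |twoActionFun T (fun _ => 1) (fun _ => 1) p - c|) (uniform V) :=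
    ((hm (fun _ => 1) (fun _ => 1)).sub (integrable_const c)).abs
  have hAB : Integrable (fun p => |twoActionFun T (fun p => f p - 1) g p| +
      |twoActionFun T (fun _ => 1) (fun p => g p - 1) p|) (uniform V) := hA.add hB
  calc ∫ p, |twoActionFun T f g p - c| ∂uniform V
      ≤ ∫ p, (|twoActionFun T (fun p => f p - 1) g p| +
          |twoActionFun T (fun _ => 1) (fun p => g p - 1) p| +
          |twoActionFun T (fun _ => 1) (fun _ => 1) p - c|) ∂uniform V := by
        refine integral_mono ((hm f g).sub (integrable_const c)).abs (hAB.add hC)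
          fun p => ?_
        have e1 := twoActionFun_add_left T (fun p => f p - 1) (fun _ => 1) g p
        have e2 := twoActionFun_add_right T (fun _ => 1) (fun p => g p - 1) (fun _ => 1) p
        simp only [sub_add_cancel] at e1 e2
        -- Bilinear telescoping: replace `f` by `1` first, then `g`; only the bound on `g` is
        -- needed.
        have e : twoActionFun T f g p - c = twoActionFun T (fun p => f p - 1) g p +
            twoActionFun T (fun _ => 1) (fun p => g p - 1) p +
            (twoActionFun T (fun _ => 1) (fun _ => 1) p - c) := by
          linarith
        change |twoActionFun T f g p - c| ≤ _
        rw [e]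
        exact abs_add_three _ _ _
    _ = (∫ p, |twoActionFun T (fun p => f p - 1) g p| ∂uniform V) +
          (∫ p, |twoActionFun T (fun _ => 1) (fun p => g p - 1) p| ∂uniform V) +
          ∫ p, |twoActionFun T (fun _ => 1) (fun _ => 1) p - c| ∂uniform V := by
        rw [integral_add hAB hC, integral_add hA hB]
    _ ≤ _ := by linarith

end Separation

/-- Inputs whose law approximates $(1,1,\cdot)$ are near 1 in $L^1$, so they cannot move the output
away from the constant `c`, whereas the approximated law has an atom at `a ≠ c`. -/
theorem not_tendsto_hausdorffEDist_profile_one {V W : ℕ → Type} [∀ n, Fintype (V n)]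
    [∀ n, Nonempty (V n)] [∀ n, Fintype (W n)] [∀ n, Nonempty (W n)]
    {H : ∀ n, Hypergraph (V n)} {H' : ∀ n, Hypergraph (W n)} {c a b : ℝ}
    (hc : |c| ≤ 1) (ha : |a| ≤ 1) (hb : |b| ≤ 1) (hac : a ≠ c)
    (h1 : Tendsto (fun n => (normalizedTwoAction (H n)).lawOne) atTop
      (𝓝 (diracProb (point 1 1 c))))
    (h2 : Tendsto (fun n => (normalizedTwoAction (H' n)).lawOne) atTop
      (𝓝 (diracMix (point 1 1 a) (point 1 1 b)))) :
    ¬ Tendsto (fun n => Metric.hausdorffEDist ((normalizedTwoAction (H n)).profile 1)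
      ((normalizedTwoAction (H' n)).profile 1)) atTop (𝓝 0) := by
  intro h
  have hmem : ∀ n, LevyProkhorov.ofMeasure (normalizedTwoAction (H' n)).lawOne ∈
      (normalizedTwoAction (H' n)).profile 1 := fun n =>
    ⟨fun _ _ => Lp.const ∞ (uniform (W n)) (1 : ℝ), fun _ _ => Eventually.of_forall fun p => by
      have h1 := congrFun (coe_const_uniform (V := W n) 1) p
      have h2 : (1 : ℝ) ∈ Set.Icc (-1 : ℝ) 1 := by simp
      exact h1.symm ▸ h2, rfl⟩
  have hex : ∀ n, ∃ f : Fin 1 → Fin 2 → Lp ℝ ∞ (uniform (V n)), (∀ a j p, |f a j p| ≤ 1) ∧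
      edist (LevyProkhorov.ofMeasure ((normalizedTwoAction (H n)).law f))
        (LevyProkhorov.ofMeasure (normalizedTwoAction (H' n)).lawOne) ≤
      Metric.hausdorffEDist ((normalizedTwoAction (H n)).profile 1)
        ((normalizedTwoAction (H' n)).profile 1) + ((n : ℝ≥0∞) + 1)⁻¹ := by
    -- The summand $1/(n+1)$ is needed because the infimum in the Hausdorff distance need not be
    -- attained.
    intro n
    have hlt : Metric.hausdorffEDist ((normalizedTwoAction (H' n)).profile 1)
        ((normalizedTwoAction (H n)).profile 1) <
        Metric.hausdorffEDist ((normalizedTwoAction (H n)).profile 1)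
          ((normalizedTwoAction (H' n)).profile 1) + ((n : ℝ≥0∞) + 1)⁻¹ := by
      rw [Metric.hausdorffEDist_comm]
      exact ENNReal.lt_add_right (ne_top_of_le_ne_top ENNReal.one_ne_top
        (MultiPOperator.hausdorffEDist_profile_le_one _ _ _)) (by simp)
    obtain ⟨ν, ⟨f, hf, rfl⟩, hν⟩ := Metric.exists_edist_lt_of_hausdorffEDist_lt (hmem n) hlt
    refine ⟨f, fun a j p => abs_le.2 ((ae_uniform_iff _).1 (hf a j) p), ?_⟩
    rw [edist_comm]
    exact hν.le
  choose f hf hfd using hex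
  have hlim : Tendsto (fun n => (normalizedTwoAction (H n)).law (f n)) atTop
      (𝓝 (diracMix (point 1 1 a) (point 1 1 b))) := by
    have hA : Tendsto (fun n => Metric.hausdorffEDist ((normalizedTwoAction (H n)).profile 1)
        ((normalizedTwoAction (H' n)).profile 1) + ((n : ℝ≥0∞) + 1)⁻¹) atTop (𝓝 0) := by
      have := (tendsto_add_atTop_iff_nat 1).2 ENNReal.tendsto_inv_nat_nhds_zero
      simpa using h.add this
    have hB := tendsto_iff_edist_tendsto_0.1
      ((LevyProkhorov.continuous_ofMeasure_probabilityMeasure.tendsto _).comp h2)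
    have hC : Tendsto (fun n => LevyProkhorov.ofMeasure ((normalizedTwoAction (H n)).law (f n)))
        atTop (𝓝 (LevyProkhorov.ofMeasure (diracMix (point 1 1 a) (point 1 1 b)))) := by
      rw [tendsto_iff_edist_tendsto_0]
      have hAB := hA.add hB
      rw [add_zero] at hAB
      refine tendsto_of_tendsto_of_tendsto_of_le_of_le tendsto_const_nhds hAB
        (fun _ => zero_le) fun n => ?_
      exact (edist_triangle _ _ _).trans (add_le_add (hfd n) le_rfl)
    exact (LevyProkhorov.continuous_toMeasure_probabilityMeasure.tendsto _).comp hC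
  have hint := ProbabilityMeasure.tendsto_iff_forall_integral_tendsto.1 hlim
  have t0 := hint (coordDist (0, (0 : Fin 2).castSucc) 1)
  have t1 := hint (coordDist (0, (1 : Fin 2).castSucc) 1)
  have t2 := hint (coordDist (0, Fin.last 2) c)
  have t3 := ProbabilityMeasure.tendsto_iff_forall_integral_tendsto.1 h1
    (coordDist (0, Fin.last 2) c)
  rw [integral_diracMix] at t0 t1 t2
  rw [integral_diracProb] at t3
  have s0 := t0.congr fun n => integral_law_coordDist_input (H n) (hf n) 0
  have s1 := t1.congr fun n => integral_law_coordDist_input (H n) (hf n) 1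
  have s2 := t2.congr fun n => integral_law_coordDist_output (H n) (hf n) hc
  have s3 := t3.congr fun n => integral_law_coordDist_output (H n)
    (f := fun _ _ => Lp.const ∞ (uniform (V n)) (1 : ℝ)) (fun _ _ p => by simp) hc
  simp only [coe_const_uniform] at s3
  -- The right-hand limits are all 0, the left-hand one is $\frac12|a-c|+\frac12|b-c|$.
  have hle := le_of_tendsto_of_tendsto' s2 ((s0.add s1).add s3) fun n =>
    (normalizedTensor_adjacencyTensor (H n)).integral_abs_twoActionFun_sub_le
      (measurable_coe_lp _) (measurable_coe_lp _) (hf n 0 1) c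
  have p0 : ∀ t : ℝ, point 1 1 t (0, (0 : Fin 2).castSucc) = 1 := fun _ => rfl
  have p1 : ∀ t : ℝ, point 1 1 t (0, (1 : Fin 2).castSucc) = 1 := fun _ => rfl
  have p2 : ∀ t : ℝ, point 1 1 t (0, Fin.last 2) = t := fun _ => rfl
  simp only [coordDist_apply, p0, p1, p2, min_abs_sub_two ha hc, min_abs_sub_two hb hc] at hle
  norm_num at hle
  have hpos : 0 < |a - c| := abs_pos.2 (sub_ne_zero.2 hac)
  linarith [abs_nonneg (b - c)]

theorem MultiPOperator.hausdorffEDist_profile_one_eq_zero {m : ℕ} {A : MultiPOperator.{u} m}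
    {B : MultiPOperator.{v} m} (h : A.actionDist B = 0) :
    Metric.hausdorffEDist (A.profile 1) (B.profile 1) = 0 := by
  have h0 := ENNReal.tsum_eq_zero.1 h 0
  simpa using h0

theorem MultiPOperator.tendsto_hausdorffEDist_of_actionDist_eq_zero {m : ℕ}
    {A B : ℕ → MultiPOperator.{0} m} {L : MultiPOperator.{v} m} {M : MultiPOperator.{w} m}
    (hA : ActionConvergesTo A L) (hB : ActionConvergesTo B M) (h : L.actionDist M = 0) :
    Tendsto (fun n => Metric.hausdorffEDist ((A n).profile 1) ((B n).profile 1)) atTop (𝓝 0) := by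
  have hsum := (hA.tendsto_profile 1).add (hB.tendsto_profile 1)
  rw [add_zero] at hsum
  refine tendsto_of_tendsto_of_tendsto_of_le_of_le tendsto_const_nhds hsum
    (fun _ => zero_le) fun n => ?_
  calc Metric.hausdorffEDist ((A n).profile 1) ((B n).profile 1)
      ≤ Metric.hausdorffEDist ((A n).profile 1) (L.profile 1) +
        Metric.hausdorffEDist (L.profile 1) ((B n).profile 1) := Metric.hausdorffEDist_triangle
    _ ≤ Metric.hausdorffEDist ((A n).profile 1) (L.profile 1) +
        (Metric.hausdorffEDist (L.profile 1) (M.profile 1) +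
          Metric.hausdorffEDist (M.profile 1) ((B n).profile 1)) := by
        gcongr
        exact Metric.hausdorffEDist_triangle
    _ = _ := by
        rw [hausdorffEDist_profile_one_eq_zero h, zero_add, Metric.hausdorffEDist_comm
          (s := M.profile 1)]

end

end ActionConv

theorem mainTheorem8 {Ξ : Type u} [MeasurableSpace Ξ] (P : Measure Ξ) [IsProbabilityMeasure P]
    (G T : ∀ n : ℕ, Ξ → Hypergraph (Fin (n + 1)))
    (hG : ∀ n, IsErdosRenyiHypergraph (G n) oneEighth 3 P)
    (hT : ∀ n, IsTriangleHypergraph (T n) oneHalf P) :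
    ∀ᵐ ξ ∂P,
      -- the laws of the operators applied to the all-ones input
      Tendsto (fun n => (normalizedTwoAction (G n ξ)).lawOne) atTop
        (𝓝 (diracProb (point 1 1 (1 / 8)))) ∧
      Tendsto (fun n => (normalizedTwoAction (T n ξ)).lawOne) atTop
        (𝓝 (diracMix (point 1 1 0) (point 1 1 (1 / 4)))) ∧
      -- every subsequence has a further subsequence with an action convergence limit
      (∀ φ : ℕ → ℕ, StrictMono φ → ∃ θ : ℕ → ℕ, StrictMono θ ∧ ∃ A : MultiPOperator.{0} 2,
        MultiPOperator.ActionConvergesTo (fun n => normalizedTwoAction (G (φ (θ n)) ξ)) A) ∧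
      (∀ ψ : ℕ → ℕ, StrictMono ψ → ∃ θ : ℕ → ℕ, StrictMono θ ∧ ∃ B : MultiPOperator.{0} 2,
        MultiPOperator.ActionConvergesTo (fun n => normalizedTwoAction (T (ψ (θ n)) ξ)) B) ∧
      -- the action convergence limits of subsequences of the two sequences are different
      (∀ φ ψ : ℕ → ℕ, StrictMono φ → StrictMono ψ →
        ∀ (A : MultiPOperator.{v} 2) (B : MultiPOperator.{w} 2),
          MultiPOperator.ActionConvergesTo (fun n => normalizedTwoAction (G (φ n) ξ)) A →
          MultiPOperator.ActionConvergesTo (fun n => normalizedTwoAction (T (ψ n) ξ)) B →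
          MultiPOperator.actionDist A B ≠ 0) := by
  filter_upwards [ae_tendsto_lawOne_erdosRenyi hG, ae_tendsto_lawOne_triangle hT] with ξ hξG hξT
  refine ⟨hξG, hξT, fun φ _ => ?_, fun ψ _ => ?_, fun φ ψ hφ hψ A B hA hB h => ?_⟩
  -- Compactness holds for every sequence of normalized tensors, so a subsequence is treated as a
  -- sequence with vertex sets of sizes `φ n + 1`.
  · exact exists_actionConvergesTo_subsequence (V := fun n => Fin (φ n + 1)) _
      fun n => normalizedTensor_adjacencyTensor (G (φ n) ξ)
  · exact exists_actionConvergesTo_subsequence (V := fun n => Fin (ψ n + 1)) _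
      fun n => normalizedTensor_adjacencyTensor (T (ψ n) ξ)
  · exact not_tendsto_hausdorffEDist_profile_one (V := fun n => Fin (φ n + 1))
      (W := fun n => Fin (ψ n + 1)) (by norm_num [abs_le]) (by norm_num) (by norm_num [abs_le])
      (by norm_num) (hξG.comp hφ.tendsto_atTop) (hξT.comp hψ.tendsto_atTop)
      (MultiPOperator.tendsto_hausdorffEDist_of_actionDist_eq_zero hA hB h)
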